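/- Let $I\ge 2$ be the number of arms. For $t\ge 1$ and $1\le i\le I$ let $Y_{i,t}$ be the real reward that arm $i$ produces in round $t$. For each $i$ the rewards $(Y_{i,t})_{t\ge1}$ are identically distributed with mean $\mu_i$ and finite variance, and the vector $(Y_{1,t},\dots,Y_{I,t})$ is independent of the collection of everything that happened in rounds $1,\dots,t-1$ together with the agent's samples and arm in round $t$ (described below). Assume $\mu_1>\mu_i$ for all $i\ge2$ and put $\Delta_i=\mu_1-\mu_i$. The agent plays an arm $A_t$ in each round $t\ge1$. Put $N_i(n)=\sum_{t=1}^n \mathbf 1\{A_t=i\}$, $\hat\mu_i(n)=\frac{1}{1+N_i(n)}\sum_{t=1}^n \mathbf 1\{A_t=i\}Y_{i,t}$ and $\hat\sigma_i^2(n)=\frac1{1+N_i(n)}$. Rewards are revealed to the agent only at the batch end points $0=T_0<T_1<T_2<\cdots$. In each round $t$ with $T_{j}<t\le T_{j+1}$ Thompson sampling draws, with fresh randomness and independently over the arms, $\theta_i(t)\sim\mathcal N(\hat\mu_i(T_j),\hat\sigma_i^2(T_j))$ and plays $A_t=\arg\max_i\theta_i(t)$. The batch end points are chosen by the iPASE rule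 $$T_{j+1}-T_j=\Big\lfloor \frac1{\mathbb P_2(T_j)}\Big\rfloor ,\qquad j\ge 0,$$ where $\mathbb P_2(T_j)$ is the second largest (counted with multiplicity) of the $I$ probabilities, one for each $i$, that an independent Gaussian vector with marginals $\mathcal N(\hat\mu_k(T_j),\hat\sigma_k^2(T_j))$, $1\le k\le I$, has its largest entry at $i$; that is, of the conditional probabilities with which arm $i$ is selected in the next batch. Let $R(T)=\sum_{t=1}^T (Y_{1,t}-Y_{A_t,t})$ be the cumulative regret and $B(T)=\max\{j\ge0: T_j\le T\}$ the number of completed batches. Then, almost surely, $$\limsup_{T\to\infty}\frac{R(T)}{\log T}\le\sum_{i=2}^I\frac{2}{\Delta_i}\qquad\text{and}\qquad \limsup_{T\to\infty}\frac{B(T)}{\log T}\le\sum_{i=2}^I\frac{2}{\Delta_i^2}.$$ -/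

import Mathlib

open MeasureTheory ProbabilityTheory Filter
open scoped NNReal

noncomputable section

namespace BatchedBandit

/-! Rounds are indexed from `0`: index `t` is round `t + 1`, so "after `n` rounds" refers to the
indices `t < n`.  First come the quantities that are functions of one realized trajectory, given by
the played arms `a : ℕ → Fin I` and the rewards `y : ℕ → Fin I → ℝ`
(`y t i` is the reward that arm `i` produces in round `t`). -/

variable {I : ℕ}

/-- Number of pulls of arm `i` during the first `n` rounds. -/
def pulls (a : ℕ → Fin I) (i : Fin I) (n : ℕ) : ℕ :=
  ((Finset.range n).filter fun t => a t = i).card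

/-- Mean of the (pseudo) posterior of arm `i` after `n` rounds. -/
def postMean (a : ℕ → Fin I) (y : ℕ → Fin I → ℝ) (n : ℕ) (i : Fin I) : ℝ :=
  (∑ t ∈ (Finset.range n).filter (fun t => a t = i), y t i) / (1 + (pulls a i n : ℝ))

/-- Variance of the (pseudo) posterior of arm `i` after `n` rounds. -/
def postVar (a : ℕ → Fin I) (n : ℕ) (i : Fin I) : ℝ≥0 :=
  1 / (1 + (pulls a i n : ℝ≥0))

/-- The law from which Thompson sampling draws the vector of samples, one for each arm and
independent across arms, when it has the feedback of the first `n` rounds. -/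
def posterior (a : ℕ → Fin I) (y : ℕ → Fin I → ℝ) (n : ℕ) : Measure (Fin I → ℝ) :=
  Measure.pi fun i => gaussianReal (postMean a y n i) (postVar a n i)

/-- Probability that Thompson sampling selects arm `i`, given the feedback of the first `n` rounds
(ties have probability zero). -/
def selProb (a : ℕ → Fin I) (y : ℕ → Fin I → ℝ) (n : ℕ) (i : Fin I) : ℝ :=
  (posterior a y n).real {x | ∀ k, x k ≤ x i}

/-- The second largest entry of `p`, counted with multiplicity: the largest value `v` such that
two different entries are at least `v`. -/
def secondLargest (p : Fin I → ℝ) : ℝ :=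
  ⨆ q : {q : Fin I × Fin I // q.1 ≠ q.2}, min (p q.1.1) (p q.1.2)

/-- The end points `T_0 = 0 < T_1 < T_2 < ⋯` of the batches under the iPASE rule. -/
def batchEnd (a : ℕ → Fin I) (y : ℕ → Fin I → ℝ) : ℕ → ℕ
  | 0 => 0
  | j + 1 => batchEnd a y j + ⌊1 / secondLargest (selProb a y (batchEnd a y j))⌋₊

/-- The number of batches completed during the first `n` rounds, the largest `j` with `T_j ≤ n`.
(For at least two arms the second largest probability lies in `(0, 1/2]`, so `T_{j+1} ≥ T_j + 2`
and the set is finite.) -/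
def completedBatches (a : ℕ → Fin I) (y : ℕ → Fin I → ℝ) (n : ℕ) : ℕ :=
  sSup {j | batchEnd a y j ≤ n}

/-- The cumulative regret of the first `n` rounds with respect to the arm `best`. -/
def regret (best : Fin I) (a : ℕ → Fin I) (y : ℕ → Fin I → ℝ) (n : ℕ) : ℝ :=
  ∑ t ∈ Finset.range n, (y t best - y t (a t))

/-! Now the random objects: `Y t ω i` is the reward that arm `i` produces in round `t`, `θ t ω i`
the sample that the agent draws for arm `i` in round `t`, and `A t ω` the arm played in round
`t`. -/

variable {Ω : Type*} [MeasurableSpace Ω]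

/-- The σ-algebra of everything that happened before round `t`: rewards of all arms (observed or
not), samples, and played arms. -/
@[reducible] def past (Y θ : ℕ → Ω → Fin I → ℝ) (A : ℕ → Ω → Fin I) (t : ℕ) : MeasurableSpace Ω :=
  ⨆ s : ℕ, ⨆ _ : s < t,
    (MeasurableSpace.comap (Y s) inferInstance ⊔ MeasurableSpace.comap (θ s) inferInstance) ⊔
      MeasurableSpace.comap (A s) inferInstance

/-- The stochastic bandit with mean rewards `μ`: the rewards of each arm are i.i.d. over the rounds,
have mean `μ i` and a finite variance, and the reward vector of a round is independent of all that
happened before and of the agent's action in this round.  (The rewards of different arms in the same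
round may depend on each other.) -/
structure IsBandit (P : Measure Ω) (μ : Fin I → ℝ) (Y θ : ℕ → Ω → Fin I → ℝ)
    (A : ℕ → Ω → Fin I) : Prop where
  measurable : ∀ t, Measurable (Y t)
  indep : ∀ t, Indep (MeasurableSpace.comap (Y t) inferInstance)
    (past Y θ A t ⊔ (MeasurableSpace.comap (θ t) inferInstance ⊔
      MeasurableSpace.comap (A t) inferInstance)) P
  identDistrib : ∀ t i, IdentDistrib (fun ω => Y t ω i) (fun ω => Y 0 ω i) P P
  memLp : ∀ i, MemLp (fun ω => Y 0 ω i) 2 P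
  mean : ∀ i, ∫ ω, Y 0 ω i ∂P = μ i

/-- The agent runs Thompson sampling with iPASE batches: in round `t`, given everything that
happened before, the samples `θ t` are drawn from the posterior that was computed at the end of the
last completed batch, and an arm with the largest sample is played. -/
structure IsThompsonSamplingIPASE (P : Measure Ω) (Y θ : ℕ → Ω → Fin I → ℝ)
    (A : ℕ → Ω → Fin I) : Prop where
  measurable_sample : ∀ t, Measurable (θ t)
  measurable_action : ∀ t, Measurable (A t)
  sample_law : ∀ t, ∀ S : Set (Fin I → ℝ), MeasurableSet S →
    P[(θ t ⁻¹' S).indicator (fun _ => (1 : ℝ)) | past Y θ A t] =ᵐ[P] fun ω =>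
      (posterior (fun s => A s ω) (fun s => Y s ω)
        (batchEnd (fun s => A s ω) (fun s => Y s ω)
          (completedBatches (fun s => A s ω) (fun s => Y s ω) t))).real S
  action_argmax : ∀ t, ∀ᵐ ω ∂P, ∀ k, θ t ω k ≤ θ t ω (A t ω)

end BatchedBandit

end

/-!
Everything that happens almost surely is extracted from three limit theorems for adapted sequences;
the rest of the argument concerns one fixed trajectory.

* A self-normalised strong law for martingale differences (`ae_tendsto_sum_div`), obtained from the
  convergence of `L²`-bounded martingales and Kronecker's lemma. Applied to the centred rewards, it
  makes the posterior means of the arms that are pulled infinitely often consistent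
  (`ae_tendsto_sum_reward`).
* The same law for the counts of pulls minus the sums of their conditional probabilities
  (`ae_tendsto_count_sub_div`).
* An exponential supermartingale bound which says that on all windows `[s, n)` the count of pulls
  exceeds a multiple of the sum of the conditional probabilities by at most `ε log n`
  (`ae_eventually_count_le`).

The conditional probability of playing arm `i` in a round is its selection probability at the start
of the current batch (`condExp_action`), because Gaussian samples have no ties.

Along a trajectory, every arm is pulled infinitely often: otherwise its posterior would freeze and
its selection probability would stay away from zero (`tendsto_pulls`). So the posteriors concentrate,
the suboptimal arms are pulled in a vanishing fraction of the rounds, and the selection probability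
of a suboptimal arm with gap `Δ` decays in its number `N` of pulls like `exp (-κ N)`, for every
`κ < Δ ^ 2 / 2` (`eventually_selProb_le_exp`). Now look at the last batch before `T` that starts with
fewer than `log T / κ` pulls of this arm. The selection probabilities during this batch sum to at
most one by the choice of the batch length, and those in later batches are at most `1 / T` each. By
the bound for windows, at most `log T / κ + ε log T` pulls occur before `T`
(`eventually_pulls_le_log`). This gives the bound on the regret, in which the centred rewards are
negligible. Moreover, the selection probabilities of the suboptimal arms sum to almost one in each
late batch, so the number of batches is at most about the number of suboptimal pulls, which bounds
the number of batches.
-/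

open scoped Topology

namespace BatchedBandit

/-! ### Self-normalised laws of large numbers for martingale differences -/

/-- Kronecker's lemma, for a weight sequence `b` that is nondecreasing, positive and unbounded. -/
lemma kronecker {x b : ℕ → ℝ} (hb : Monotone b) (hpos : ∀ n, 0 < b n)
    (htop : Tendsto b atTop atTop) {c : ℝ}
    (hx : Tendsto (fun n => ∑ t ∈ Finset.range n, x t / b t) atTop (𝓝 c)) :
    Tendsto (fun n => (∑ t ∈ Finset.range (n + 1), x t) / b n) atTop (𝓝 0) := by
  set d : ℕ → ℝ := fun n => (∑ t ∈ Finset.range n, x t / b t) - c with hd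
  have hd0 : Tendsto d atTop (𝓝 0) := by simpa using hx.sub_const c
  -- summation by parts
  have key : ∀ n, ∑ t ∈ Finset.range (n + 1), x t =
      b n * d (n + 1) - b 0 * d 0 - ∑ t ∈ Finset.range n, (b (t + 1) - b t) * d (t + 1) := by
    have hdx : ∀ n, x n = b n * (d (n + 1) - d n) := by
      intro n
      have := (hpos n).ne'
      simp only [hd, Finset.sum_range_succ]
      field_simp
      ring
    intro n
    induction n with
    | zero => simp [hdx 0]; ring
    | succ n ih => rw [Finset.sum_range_succ, ih, Finset.sum_range_succ _ n, hdx (n + 1)]; ring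
  have hsumtop : Tendsto (fun n => ∑ t ∈ Finset.range n, (b (t + 1) - b t)) atTop atTop := by
    simp_rw [Finset.sum_range_sub]
    exact tendsto_atTop_add_const_right _ (-b 0) htop
  have ho : (fun t => (b (t + 1) - b t) * d (t + 1)) =o[atTop] fun t => b (t + 1) - b t := by
    have h1 : (fun t => d (t + 1)) =o[atTop] fun _ => (1 : ℝ) :=
      (Asymptotics.isLittleO_one_iff ℝ).2 (hd0.comp (tendsto_add_atTop_nat 1))
    simpa using (Asymptotics.isBigO_refl (fun t => b (t + 1) - b t) atTop).mul_isLittleO h1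
  have ho2 := ho.sum_range (fun t => sub_nonneg.2 (hb (Nat.le_succ t))) hsumtop
  have hO : (fun n => ∑ t ∈ Finset.range n, (b (t + 1) - b t)) =O[atTop] b := by
    refine Asymptotics.IsBigO.of_bound 1 (Eventually.of_forall fun n => ?_)
    rw [Finset.sum_range_sub, Real.norm_of_nonneg (sub_nonneg.2 (hb (Nat.zero_le n))),
      Real.norm_of_nonneg (hpos n).le]
    linarith [hpos 0]
  have h3 := (ho2.trans_isBigO hO).tendsto_div_nhds_zero
  have h4 : Tendsto (fun n => d (n + 1) - b 0 * d 0 / b n -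
      (∑ t ∈ Finset.range n, (b (t + 1) - b t) * d (t + 1)) / b n) atTop (𝓝 0) := by
    simpa using ((hd0.comp (tendsto_add_atTop_nat 1)).sub
      (htop.const_div_atTop (b 0 * d 0))).sub h3
  refine h4.congr fun n => ?_
  rw [key n]
  have := (hpos n).ne'
  field_simp

section Martingale

variable {Ω : Type*} {mΩ : MeasurableSpace Ω} {P : Measure Ω} [IsProbabilityMeasure P]

/-- A bounded factor that is measurable with respect to the conditioning σ-algebra can be pulled
into the conditional expectation, under the expectation. -/
lemma integral_mul_condExp {m : MeasurableSpace Ω} (hm : m ≤ mΩ) {h X : Ω → ℝ}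
    (hh : StronglyMeasurable[m] h) (hX : Integrable X P) {c : ℝ} (hc : ∀ ω, |h ω| ≤ c) :
    ∫ ω, h ω * (P[X | m]) ω ∂P = ∫ ω, h ω * X ω ∂P := by
  have h1 := condExp_stronglyMeasurable_mul_of_bound hm hh hX c (Eventually.of_forall hc)
  have h2 := integral_condExp (μ := P) (f := h * X) hm
  rw [integral_congr_ae h1] at h2
  exact h2

/-- A series of martingale differences whose variances have a finite sum converges. -/
lemma ae_exists_tendsto_sum (F : Filtration ℕ mΩ) {x : ℕ → Ω → ℝ}
    (hmeas : ∀ t, StronglyMeasurable[F (t + 1)] (x t)) (hL2 : ∀ t, MemLp (x t) 2 P)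
    (hzero : ∀ t, P[x t | F t] =ᵐ[P] 0) {C : ℝ}
    (hC : ∀ n, ∑ t ∈ Finset.range n, ∫ ω, (x t ω) ^ 2 ∂P ≤ C) :
    ∀ᵐ ω ∂P, ∃ c, Tendsto (fun n => ∑ t ∈ Finset.range n, x t ω) atTop (𝓝 c) := by
  set M : ℕ → Ω → ℝ := fun n => ∑ t ∈ Finset.range n, x t with hM
  have hMmeas : ∀ n, StronglyMeasurable[F n] (M n) := fun n =>
    Finset.stronglyMeasurable_sum _ fun t ht =>
      (hmeas t).mono (F.mono (Finset.mem_range.1 ht))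
  have hM2 : ∀ n, MemLp (M n) 2 P := fun n => memLp_finsetSum' _ fun t _ => hL2 t
  have hMart : Martingale M F P := by
    refine martingale_of_condExp_sub_eq_zero_nat hMmeas
      (fun n => (hM2 n).integrable one_le_two) fun n => ?_
    have : M (n + 1) - M n = x n := by simp [hM, Finset.sum_range_succ]
    rw [this]
    exact hzero n
  have hsq : ∀ n, ∫ ω, (M n ω) ^ 2 ∂P = ∑ t ∈ Finset.range n, ∫ ω, (x t ω) ^ 2 ∂P := by
    intro n
    induction n with
    | zero => simp [hM]
    | succ n ih =>
      have hint : Integrable (M n * x n) P := (hM2 n).integrable_mul (hL2 n)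
      have hcross : ∫ ω, M n ω * x n ω ∂P = 0 := by
        have h1 := condExp_mul_of_stronglyMeasurable_left (m := F n) (hMmeas n) hint
          ((hL2 n).integrable one_le_two)
        have h2 : ∫ ω, (P[M n * x n | F n]) ω ∂P = ∫ ω, (M n * x n) ω ∂P :=
          integral_condExp (F.le n)
        have h3 : ∫ ω, (P[M n * x n | F n]) ω ∂P = ∫ _, (0 : ℝ) ∂P := by
          refine integral_congr_ae ?_
          filter_upwards [h1, hzero n] with ω h h'
          rw [h, Pi.mul_apply, h']
          simp
        rw [h3] at h2
        simpa using h2.symm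
      have hexp : ∀ ω, (M (n + 1) ω) ^ 2 = (M n ω) ^ 2 + 2 * (M n ω * x n ω) + (x n ω) ^ 2 := by
        intro ω
        have : M (n + 1) ω = M n ω + x n ω := by simp [hM, Finset.sum_range_succ]
        rw [this]; ring
      have hint2 : Integrable (fun ω => 2 * (M n ω * x n ω)) P := hint.const_mul 2
      have hint1 : Integrable (fun ω => (M n ω) ^ 2 + 2 * (M n ω * x n ω)) P :=
        (hM2 n).integrable_sq.add hint2
      simp_rw [hexp]
      rw [integral_add hint1 (hL2 n).integrable_sq,
        integral_add (hM2 n).integrable_sq hint2, integral_const_mul, hcross, ih,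
        Finset.sum_range_succ]
      ring
  have hbdd : ∀ n, eLpNorm (M n) 1 P ≤ ((1 + C).toNNReal : ENNReal) := by
    intro n
    rw [eLpNorm_one_eq_lintegral_enorm,
      ← ofReal_integral_norm_eq_lintegral_enorm ((hM2 n).integrable one_le_two)]
    refine ENNReal.ofReal_le_ofReal ?_
    calc ∫ ω, ‖M n ω‖ ∂P ≤ ∫ ω, (1 + (M n ω) ^ 2) ∂P := by
          refine integral_mono ((hM2 n).integrable one_le_two).norm
            ((integrable_const 1).add (hM2 n).integrable_sq) fun ω => ?_
          simp only [Real.norm_eq_abs]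
          nlinarith [sq_abs (M n ω), sq_nonneg (|M n ω| - 1)]
      _ = 1 + ∑ t ∈ Finset.range n, ∫ ω, (x t ω) ^ 2 ∂P := by
          rw [integral_add (integrable_const 1) (hM2 n).integrable_sq, hsq]; simp
      _ ≤ 1 + C := by linarith [hC n]
  filter_upwards [hMart.submartingale.exists_ae_tendsto_of_bdd hbdd] with ω hω
  simpa [hM, Finset.sum_apply] using hω

/-- The terms `u t / (1 + U (t + 1)) ^ 2`, where `U` are the partial sums of `u`, are dominated by a
telescoping sum. -/
lemma sum_div_sq_le_one {u : ℕ → ℝ} (hu : ∀ t, 0 ≤ u t) (n : ℕ) :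
    ∑ t ∈ Finset.range n, u t / (1 + ∑ s ∈ Finset.range (t + 1), u s) ^ 2 ≤ 1 := by
  have hU : ∀ n, 0 ≤ ∑ s ∈ Finset.range n, u s := fun n => Finset.sum_nonneg fun s _ => hu s
  suffices h : ∑ t ∈ Finset.range n, u t / (1 + ∑ s ∈ Finset.range (t + 1), u s) ^ 2 ≤
      1 - 1 / (1 + ∑ s ∈ Finset.range n, u s) by
    have : 0 ≤ 1 / (1 + ∑ s ∈ Finset.range n, u s) := by have := hU n; positivity
    linarith
  induction n with
  | zero => simp
  | succ n ih =>
    rw [Finset.sum_range_succ]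
    have h1 := hU n
    have h2 := hu n
    rw [Finset.sum_range_succ _ n]
    set U := ∑ s ∈ Finset.range n, u s
    have : u n / (1 + (U + u n)) ^ 2 ≤ 1 / (1 + U) - 1 / (1 + (U + u n)) := by
      rw [div_sub_div _ _ (by positivity) (by positivity), div_le_div_iff₀ (by positivity)
        (by positivity)]
      nlinarith [mul_nonneg h2 h2, mul_nonneg (mul_nonneg h2 h2) (by positivity : 0 ≤ 1 + (U + u n))]
    linarith

/-- Self-normalised strong law of large numbers: martingale differences `ξ t` whose conditional
variances are at most `σ u t`, with `u t` predictable, are negligible with respect to the partial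
sums of `u` wherever these diverge. -/
lemma ae_tendsto_sum_div (F : Filtration ℕ mΩ) {ξ u : ℕ → Ω → ℝ} {σ : ℝ}
    (hξ : ∀ t, StronglyMeasurable[F (t + 1)] (ξ t)) (hL2 : ∀ t, MemLp (ξ t) 2 P)
    (hzero : ∀ t, P[ξ t | F t] =ᵐ[P] 0)
    (hu : ∀ t, StronglyMeasurable[F t] (u t)) (hu0 : ∀ t ω, 0 ≤ u t ω) (hu1 : ∀ t ω, u t ω ≤ 1)
    (hvar : ∀ t, P[fun ω => (ξ t ω) ^ 2 | F t] ≤ᵐ[P] fun ω => σ * u t ω) (hσ : 0 ≤ σ) :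
    ∀ᵐ ω ∂P, Tendsto (fun n => ∑ t ∈ Finset.range n, u t ω) atTop atTop →
      Tendsto (fun n => (∑ t ∈ Finset.range n, ξ t ω) / (1 + ∑ t ∈ Finset.range n, u t ω))
        atTop (𝓝 0) := by
  set b : ℕ → Ω → ℝ := fun t ω => 1 + ∑ s ∈ Finset.range (t + 1), u s ω with hb
  have hb1 : ∀ t ω, 1 ≤ b t ω := fun t ω => by
    have : 0 ≤ ∑ s ∈ Finset.range (t + 1), u s ω := Finset.sum_nonneg fun s _ => hu0 s ω
    simp only [hb]; linarith
  have hbm : ∀ t, StronglyMeasurable[F t] (b t) := fun t =>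
    stronglyMeasurable_const.add (Finset.stronglyMeasurable_fun_sum _ fun s hs =>
      (hu s).mono (F.mono (Nat.lt_succ_iff.1 (Finset.mem_range.1 hs))))
  have hinvm : ∀ t, StronglyMeasurable[F t] (fun ω => (b t ω)⁻¹) := fun t =>
    ((hbm t).measurable.inv).stronglyMeasurable
  have hinvb : ∀ t ω, |(b t ω)⁻¹| ≤ 1 := fun t ω => by
    rw [abs_of_nonneg (inv_nonneg.2 (zero_le_one.trans (hb1 t ω)))]
    exact inv_le_one_of_one_le₀ (hb1 t ω)
  have hxL2 : ∀ t, MemLp (fun ω => (b t ω)⁻¹ * ξ t ω) 2 P := fun t => by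
    refine (hL2 t).mono (((hinvm t).mono (F.le t)).aestronglyMeasurable.mul (hL2 t).1)
      (Eventually.of_forall fun ω => ?_)
    rw [norm_mul]
    exact mul_le_of_le_one_left (norm_nonneg _) (hinvb t ω)
  have hvart : ∀ t, ∫ ω, ((b t ω)⁻¹ * ξ t ω) ^ 2 ∂P ≤
      σ * ∫ ω, u t ω / (b t ω) ^ 2 ∂P := by
    intro t
    have hwm : StronglyMeasurable[F t] (fun ω => ((b t ω)⁻¹) ^ 2) := (hinvm t).pow 2
    have hwb : ∀ ω, |((b t ω)⁻¹) ^ 2| ≤ 1 := fun ω => by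
      rw [abs_pow]; exact pow_le_one₀ (abs_nonneg _) (hinvb t ω)
    have h1 := integral_mul_condExp (F.le t) hwm (hL2 t).integrable_sq hwb
    simp_rw [mul_pow]
    rw [← h1, ← integral_const_mul]
    refine integral_mono_ae ?_ ?_ ?_
    · exact (integrable_condExp (m := F t)).bdd_mul (c := 1)
        (hwm.mono (F.le t)).aestronglyMeasurable (Eventually.of_forall hwb)
    · refine (Integrable.of_bound (C := 1) ?_ (Eventually.of_forall fun ω => ?_)).const_mul σ
      · exact ((((hu t).mono (F.le t)).measurable.div
          (((hbm t).mono (F.le t)).measurable.pow_const 2))).aestronglyMeasurable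
      · rw [Real.norm_eq_abs, abs_of_nonneg (div_nonneg (hu0 t ω) (sq_nonneg _))]
        have := hb1 t ω
        exact div_le_one_of_le₀ ((hu1 t ω).trans (one_le_pow₀ this)) (sq_nonneg _)
    · filter_upwards [hvar t] with ω hω
      calc ((b t ω)⁻¹) ^ 2 * (P[fun ω => (ξ t ω) ^ 2 | F t]) ω
          ≤ ((b t ω)⁻¹) ^ 2 * (σ * u t ω) := mul_le_mul_of_nonneg_left hω (sq_nonneg _)
        _ = σ * (u t ω / (b t ω) ^ 2) := by rw [inv_pow]; ring
  have hconv := ae_exists_tendsto_sum F (x := fun t ω => (b t ω)⁻¹ * ξ t ω) (P := P) (C := σ)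
    (fun t => ((hinvm t).mono (F.mono t.le_succ)).mul (hξ t)) hxL2 (fun t => by
      have h1 := condExp_stronglyMeasurable_mul_of_bound (F.le t) (hinvm t)
        ((hL2 t).integrable one_le_two) 1 (Eventually.of_forall (hinvb t))
      filter_upwards [h1, hzero t] with ω h h'
      change (P[(fun ω => (b t ω)⁻¹) * ξ t | F t]) ω = 0
      rw [h, Pi.mul_apply, h']
      simp) (fun n => by
      calc ∑ t ∈ Finset.range n, ∫ ω, ((b t ω)⁻¹ * ξ t ω) ^ 2 ∂P
          ≤ ∑ t ∈ Finset.range n, σ * ∫ ω, u t ω / (b t ω) ^ 2 ∂P :=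
            Finset.sum_le_sum fun t _ => hvart t
        _ = σ * ∫ ω, ∑ t ∈ Finset.range n, u t ω / (b t ω) ^ 2 ∂P := by
            rw [← Finset.mul_sum, integral_finsetSum]
            intro t _
            refine Integrable.of_bound (C := 1) ?_ (Eventually.of_forall fun ω => ?_)
            · exact ((((hu t).mono (F.le t)).measurable.div
                (((hbm t).mono (F.le t)).measurable.pow_const 2))).aestronglyMeasurable
            · rw [Real.norm_eq_abs, abs_of_nonneg (div_nonneg (hu0 t ω) (sq_nonneg _))]
              have := hb1 t ω
              exact div_le_one_of_le₀ ((hu1 t ω).trans (one_le_pow₀ this)) (sq_nonneg _)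
        _ ≤ σ * 1 := by
            refine mul_le_mul_of_nonneg_left ?_ hσ
            calc ∫ ω, ∑ t ∈ Finset.range n, u t ω / (b t ω) ^ 2 ∂P ≤ ∫ _, (1 : ℝ) ∂P := by
                  refine integral_mono_of_nonneg (Eventually.of_forall fun ω =>
                    Finset.sum_nonneg fun t _ => div_nonneg (hu0 t ω) (sq_nonneg _))
                    (integrable_const 1) (Eventually.of_forall fun ω => ?_)
                  exact sum_div_sq_le_one (fun t => hu0 t ω) n
              _ = 1 := by simp
        _ = σ := mul_one σ)
  filter_upwards [hconv] with ω ⟨c, hc⟩ htop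
  have hk := kronecker (x := fun t => ξ t ω) (b := fun t => b t ω)
    (monotone_nat_of_le_succ fun t => by
      simp only [hb]; rw [Finset.sum_range_succ _ (t + 1)]; linarith [hu0 (t + 1) ω])
    (fun n => zero_lt_one.trans_le (hb1 n ω))
    (tendsto_atTop_add_const_left _ 1 (htop.comp (tendsto_add_atTop_nat 1)))
    (hc.congr fun n => Finset.sum_congr rfl fun t _ => by rw [div_eq_inv_mul])
  exact (tendsto_add_atTop_iff_nat 1).1 hk

/-! ### Counting processes and their compensators -/

/-- A counting process with steps `D t ∈ {0, 1}` is asymptotically equivalent to the sum of the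
conditional probabilities `q t` of its steps wherever the latter diverges. -/
lemma ae_tendsto_count_sub_div (F : Filtration ℕ mΩ) {D q : ℕ → Ω → ℝ}
    (hD : ∀ t, StronglyMeasurable[F (t + 1)] (D t)) (hD01 : ∀ t ω, D t ω = 0 ∨ D t ω = 1)
    (hq : ∀ t, StronglyMeasurable[F t] (q t)) (hq0 : ∀ t ω, 0 ≤ q t ω) (hq1 : ∀ t ω, q t ω ≤ 1)
    (hDq : ∀ t, P[D t | F t] =ᵐ[P] q t) :
    ∀ᵐ ω ∂P, Tendsto (fun n => ∑ t ∈ Finset.range n, q t ω) atTop atTop →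
      Tendsto (fun n => (∑ t ∈ Finset.range n, (D t ω - q t ω)) /
        (1 + ∑ t ∈ Finset.range n, q t ω)) atTop (𝓝 0) := by
  have hDi : ∀ t, Integrable (D t) P := fun t => Integrable.of_bound (C := 1)
    ((hD t).mono (F.le _)).aestronglyMeasurable
    (Eventually.of_forall fun ω => by rcases hD01 t ω with h | h <;> simp [h])
  have hqi : ∀ t, Integrable (q t) P := fun t => Integrable.of_bound (C := 1)
    ((hq t).mono (F.le _)).aestronglyMeasurable
    (Eventually.of_forall fun ω => by rw [Real.norm_of_nonneg (hq0 t ω)]; exact hq1 t ω)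
  have hqb : ∀ t ω, ‖q t ω‖ ≤ 1 := fun t ω => by
    rw [Real.norm_of_nonneg (hq0 t ω)]; exact hq1 t ω
  have hxm : ∀ t, StronglyMeasurable[F (t + 1)] (fun ω => D t ω - q t ω) := fun t =>
    (hD t).sub ((hq t).mono (F.mono t.le_succ))
  refine ae_tendsto_sum_div F (ξ := fun t ω => D t ω - q t ω) (u := q) (σ := 1) hxm ?_ ?_ hq hq0
    hq1 ?_ zero_le_one
  · refine fun t => MemLp.of_bound ((hxm t).mono (F.le _)).aestronglyMeasurable 1
      (Eventually.of_forall fun ω => ?_)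
    have h0 := hq0 t ω
    have h1 := hq1 t ω
    rw [Real.norm_eq_abs, abs_le]
    rcases hD01 t ω with h | h <;> rw [h] <;> constructor <;> linarith
  · intro t
    filter_upwards [condExp_sub (m := F t) (hDi t) (hqi t), hDq t] with ω h1 h2
    change (P[D t - q t | F t]) ω = 0
    rw [h1, Pi.sub_apply, h2, condExp_of_stronglyMeasurable (F.le t) (hq t) (hqi t), sub_self]
  · intro t
    -- `(D - q) ^ 2 = (1 - 2 q) D + q ^ 2`, as `D` is an indicator
    have hcm : StronglyMeasurable[F t] (fun ω => 1 - 2 * q t ω) :=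
      stronglyMeasurable_const.sub ((hq t).const_mul 2)
    have hcb : ∀ ω, ‖1 - 2 * q t ω‖ ≤ 1 := fun ω => by
      rw [Real.norm_eq_abs, abs_le]
      constructor <;> linarith [hq0 t ω, hq1 t ω]
    have hsqm : StronglyMeasurable[F t] (fun ω => (q t ω) ^ 2) := (hq t).pow 2
    have hsqi : Integrable (fun ω => (q t ω) ^ 2) P := Integrable.of_bound (C := 1)
      (hsqm.mono (F.le _)).aestronglyMeasurable
      (Eventually.of_forall fun ω => by rw [norm_pow]; exact pow_le_one₀ (norm_nonneg _) (hqb t ω))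
    have hprod : Integrable ((fun ω => 1 - 2 * q t ω) * D t) P :=
      (hDi t).bdd_mul (c := 1) (hcm.mono (F.le _)).aestronglyMeasurable (Eventually.of_forall hcb)
    have heq : (fun ω => (D t ω - q t ω) ^ 2) =
        (fun ω => 1 - 2 * q t ω) * D t + fun ω => (q t ω) ^ 2 := by
      funext ω
      simp only [Pi.add_apply, Pi.mul_apply]
      rcases hD01 t ω with h | h <;> rw [h] <;> ring
    rw [heq]
    filter_upwards [condExp_add (m := F t) hprod hsqi, hDq t,
      condExp_stronglyMeasurable_mul_of_bound (F.le t) hcm (hDi t) 1 (Eventually.of_forall hcb)]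
      with ω h1 h2 h3
    rw [h1, Pi.add_apply, h3, Pi.mul_apply, h2,
      condExp_of_stronglyMeasurable (F.le t) hsqm hsqi]
    nlinarith [sq_nonneg (q t ω)]

/-- The exponential supermartingale of a counting process has expectation at most one. -/
lemma integral_exp_count_le_one (F : Filtration ℕ mΩ) {D q : ℕ → Ω → ℝ}
    (hD : ∀ t, StronglyMeasurable[F (t + 1)] (D t)) (hD01 : ∀ t ω, D t ω = 0 ∨ D t ω = 1)
    (hq : ∀ t, StronglyMeasurable[F t] (q t)) (hq0 : ∀ t ω, 0 ≤ q t ω)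
    (hDq : ∀ t, P[D t | F t] =ᵐ[P] q t) {l : ℝ} (hl : 0 ≤ l) (s n : ℕ) :
    Integrable (fun ω => Real.exp (∑ t ∈ Finset.Ico s n,
        (l * D t ω - (Real.exp l - 1) * q t ω))) P ∧
      ∫ ω, Real.exp (∑ t ∈ Finset.Ico s n, (l * D t ω - (Real.exp l - 1) * q t ω)) ∂P ≤ 1 := by
  set c := Real.exp l - 1 with hc
  have hc0 : 0 ≤ c := by rw [hc]; linarith [Real.one_le_exp hl]
  set Z : ℕ → Ω → ℝ := fun n ω => Real.exp (∑ t ∈ Finset.Ico s n, (l * D t ω - c * q t ω)) with hZ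
  have hZm : ∀ n, StronglyMeasurable[F n] (Z n) := fun n =>
    Real.continuous_exp.comp_stronglyMeasurable <|
      Finset.stronglyMeasurable_fun_sum _ fun t ht => by
        have htn := (Finset.mem_Ico.1 ht).2
        exact (((hD t).mono (F.mono htn)).const_mul l).sub
          (((hq t).mono (F.mono htn.le)).const_mul c)
  have hZb : ∀ n ω, Z n ω ≤ Real.exp (∑ t ∈ Finset.Ico s n, l) := fun n ω =>
    Real.exp_le_exp.2 <| Finset.sum_le_sum fun t _ => by
      have := mul_nonneg hc0 (hq0 t ω)
      rcases hD01 t ω with h | h <;> rw [h] <;> linarith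
  have hZi : ∀ n, Integrable (Z n) P := fun n => Integrable.of_bound
    ((hZm n).mono (F.le n)).aestronglyMeasurable (Real.exp (∑ t ∈ Finset.Ico s n, l))
    (Eventually.of_forall fun ω => by
      rw [Real.norm_of_nonneg (Real.exp_pos _).le]; exact hZb n ω)
  refine ⟨hZi n, ?_⟩
  change ∫ ω, Z n ω ∂P ≤ 1
  induction n with
  | zero => simp [hZ]
  | succ n ih =>
    rcases lt_or_ge n s with hns | hns
    · have : ∀ ω, Z (n + 1) ω = 1 := fun ω => by simp [hZ, Finset.Ico_eq_empty_of_le (Nat.succ_le_of_lt hns)]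
      simp [this]
    set h : Ω → ℝ := fun ω => Z n ω * Real.exp (-(c * q n ω)) with hh
    have hhm : StronglyMeasurable[F n] h := (hZm n).mul
      (Real.continuous_exp.comp_stronglyMeasurable ((hq n).const_mul c).neg)
    have hh0 : ∀ ω, 0 ≤ h ω := fun ω => mul_nonneg (Real.exp_pos _).le (Real.exp_pos _).le
    have hhb : ∀ ω, |h ω| ≤ Real.exp (∑ t ∈ Finset.Ico s n, l) := fun ω => by
      rw [abs_of_nonneg (hh0 ω)]
      refine (mul_le_of_le_one_right (Real.exp_pos _).le ?_).trans (hZb n ω)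
      exact Real.exp_le_one_iff.2 (neg_nonpos.2 (mul_nonneg hc0 (hq0 n ω)))
    have hhi : Integrable h P := Integrable.of_bound (hhm.mono (F.le n)).aestronglyMeasurable _
      (Eventually.of_forall hhb)
    have hDi : Integrable (D n) P := Integrable.of_bound (C := 1)
      ((hD n).mono (F.le _)).aestronglyMeasurable
      (Eventually.of_forall fun ω => by rcases hD01 n ω with h | h <;> simp [h])
    have hhD : Integrable (fun ω => h ω * D n ω) P := hDi.bdd_mul
      (hhm.mono (F.le _)).aestronglyMeasurable (Eventually.of_forall hhb)
    have hhq : Integrable (fun ω => h ω * q n ω) P :=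
      ((integrable_condExp (m := F n) (f := D n)).congr (hDq n)).bdd_mul
        (hhm.mono (F.le _)).aestronglyMeasurable (Eventually.of_forall hhb)
    have hstep : ∀ ω, Z (n + 1) ω = h ω + c * (h ω * D n ω) := fun ω => by
      simp only [hZ, hh, Finset.sum_Ico_succ_top hns]
      rw [Real.exp_add, sub_eq_add_neg, Real.exp_add]
      rcases hD01 n ω with h | h <;> rw [h]
      · simp
      · rw [mul_one, hc]; ring
    have hpull : ∫ ω, h ω * D n ω ∂P = ∫ ω, h ω * q n ω ∂P := by
      rw [← integral_mul_condExp (F.le n) hhm hDi hhb]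
      exact integral_congr_ae ((hDq n).mono fun ω hω => by simp only [hω])
    calc ∫ ω, Z (n + 1) ω ∂P = ∫ ω, h ω ∂P + c * ∫ ω, h ω * D n ω ∂P := by
          simp_rw [hstep]
          rw [integral_add hhi (hhD.const_mul c), integral_const_mul]
      _ = ∫ ω, (h ω + c * (h ω * q n ω)) ∂P := by
          rw [hpull, integral_add hhi (hhq.const_mul c), integral_const_mul]
      _ ≤ ∫ ω, Z n ω ∂P := by
          refine integral_mono (hhi.add (hhq.const_mul c)) (hZi n) fun ω => ?_
          have h1 : 1 + c * q n ω ≤ Real.exp (c * q n ω) := by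
            linarith [Real.add_one_le_exp (c * q n ω)]
          calc h ω + c * (h ω * q n ω) = h ω * (1 + c * q n ω) := by ring
            _ ≤ h ω * Real.exp (c * q n ω) := mul_le_mul_of_nonneg_left h1 (hh0 ω)
            _ = Z n ω := by
              simp only [hh]
              rw [mul_assoc, ← Real.exp_add, neg_add_cancel, Real.exp_zero, mul_one]
      _ ≤ 1 := ih

/-- On every window that ends at a late time `n`, a counting process exceeds its compensator, up to
constants depending on `l`, by at most a logarithm of `n`.  For large `l` the logarithmic term,
which is divided by `l`, becomes negligible. -/
lemma ae_eventually_count_le (F : Filtration ℕ mΩ) {D q : ℕ → Ω → ℝ}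
    (hD : ∀ t, StronglyMeasurable[F (t + 1)] (D t)) (hD01 : ∀ t ω, D t ω = 0 ∨ D t ω = 1)
    (hq : ∀ t, StronglyMeasurable[F t] (q t)) (hq0 : ∀ t ω, 0 ≤ q t ω)
    (hDq : ∀ t, P[D t | F t] =ᵐ[P] q t) {l : ℝ} (hl : 0 ≤ l) :
    ∀ᵐ ω ∂P, ∀ᶠ n : ℕ in atTop, ∀ s ≤ n,
      l * ∑ t ∈ Finset.Ico s n, D t ω ≤
        (Real.exp l - 1) * ∑ t ∈ Finset.Ico s n, q t ω + 3 * Real.log (n + 1) := by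
  set c := Real.exp l - 1 with hc
  set Z : ℕ → ℕ → Ω → ℝ := fun s n ω =>
    Real.exp (∑ t ∈ Finset.Ico s n, (l * D t ω - c * q t ω)) with hZ
  have hZ1 := fun s n => integral_exp_count_le_one F hD hD01 hq hq0 hDq hl s n
  -- Markov's inequality at level `(n + 1) ^ 3`: the union over the `n + 1` windows that end at `n`
  -- still has the summable probability `(n + 1) ^ (-2)`
  set B : ℕ → Set Ω := fun n => ⋃ s ∈ Finset.range (n + 1), {ω | ((n : ℝ) + 1) ^ 3 ≤ Z s n ω} with hB
  have hBle : ∀ n, P (B n) ≤ ENNReal.ofReal (1 / ((n : ℝ) + 1) ^ 2) := by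
    intro n
    have h1 : ∀ s, P {ω | ((n : ℝ) + 1) ^ 3 ≤ Z s n ω} ≤
        ENNReal.ofReal (1 / ((n : ℝ) + 1) ^ 3) := by
      intro s
      have hM := mul_meas_ge_le_integral_of_nonneg (μ := P) (f := Z s n)
        (Eventually.of_forall fun ω => (Real.exp_pos _).le) (hZ1 s n).1 (((n : ℝ) + 1) ^ 3)
      have hpos : 0 < ((n : ℝ) + 1) ^ 3 := by positivity
      rw [← ofReal_measureReal]
      refine ENNReal.ofReal_le_ofReal ?_
      rw [le_div_iff₀ hpos, mul_comm]
      exact hM.trans (hZ1 s n).2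
    calc P (B n) ≤ ∑ s ∈ Finset.range (n + 1), P {ω | ((n : ℝ) + 1) ^ 3 ≤ Z s n ω} :=
          measure_biUnion_finset_le _ _
      _ ≤ ∑ _s ∈ Finset.range (n + 1), ENNReal.ofReal (1 / ((n : ℝ) + 1) ^ 3) :=
          Finset.sum_le_sum fun s _ => h1 s
      _ = ENNReal.ofReal (1 / ((n : ℝ) + 1) ^ 2) := by
          rw [Finset.sum_const, Finset.card_range, ← ENNReal.ofReal_nsmul]
          congr 1
          rw [nsmul_eq_mul]
          push_cast
          field_simp
  have hsum : ∑' n, P (B n) ≠ ⊤ := by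
    have hs : Summable fun n : ℕ => 1 / ((n : ℝ) + 1) ^ 2 := by
      have := (summable_nat_add_iff 1).2 (Real.summable_one_div_nat_pow.2 one_lt_two)
      simpa using this
    refine ne_top_of_le_ne_top ?_ (ENNReal.tsum_le_tsum hBle)
    rw [← ENNReal.ofReal_tsum_of_nonneg (fun n => by positivity) hs]
    exact ENNReal.ofReal_ne_top
  filter_upwards [ae_eventually_notMem hsum] with ω hω
  filter_upwards [hω] with n hn s hs
  have hZlt : Z s n ω < ((n : ℝ) + 1) ^ 3 := by
    by_contra hcon
    exact hn (Set.mem_biUnion (Finset.mem_coe.2 (Finset.mem_range.2 (Nat.lt_succ_iff.2 hs)))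
      (not_lt.1 hcon))
  have h2 := (Real.lt_log_iff_exp_lt (by positivity)).2 hZlt
  rw [Real.log_pow, Finset.sum_sub_distrib, ← Finset.mul_sum, ← Finset.mul_sum] at h2
  push_cast at h2
  linarith

end Martingale

/-! ### Gaussian argmax probabilities -/

lemma gaussianReal_Ici_le {m c : ℝ} {v : ℝ≥0} (hv : v ≠ 0) (hmc : m ≤ c) :
    (gaussianReal m v).real (Set.Ici c) ≤ Real.exp (-(c - m) ^ 2 / (2 * v)) := by
  have hv' : (0 : ℝ) < v := NNReal.coe_pos.2 (pos_iff_ne_zero.2 hv)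
  -- Chernoff's bound with the optimal exponent `(c - m) / v`
  have h := measure_ge_le_exp_mul_mgf (μ := gaussianReal m v) (X := id) (t := (c - m) / v) c
    (div_nonneg (sub_nonneg.2 hmc) hv'.le) (integrable_exp_mul_gaussianReal _)
  rw [mgf_id_gaussianReal, ← Real.exp_add] at h
  refine h.trans (le_of_eq ?_)
  congr 1
  field_simp
  ring

lemma gaussianReal_Ici_pos (m c : ℝ) {v : ℝ≥0} (hv : v ≠ 0) :
    0 < (gaussianReal m v).real (Set.Ici c) := by
  refine ENNReal.toReal_pos (fun h => ?_) (measure_ne_top _ _)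
  have := gaussianReal_absolutelyContinuous' m hv h
  simp at this

section Pi

variable {ι : Type*} [Fintype ι] (m : ι → ℝ) {v : ι → ℝ≥0}

lemma pi_gaussianReal_map_sub {i k : ι} (hik : i ≠ k) :
    (Measure.pi fun j => gaussianReal (m j) (v j)).map (fun x => x i - x k) =
      gaussianReal (m i - m k) (v i + v k) := by
  set π := Measure.pi fun j => gaussianReal (m j) (v j)
  have hev : ∀ j, π.map (fun x => x j) = gaussianReal (m j) (v j) := fun j =>
    (measurePreserving_eval (fun j => gaussianReal (m j) (v j)) j).map_eq
  have hind : iIndepFun (fun j (x : ι → ℝ) => x j) π :=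
    iIndepFun_pi (X := fun _ y => y) fun _ => aemeasurable_id'
  have hneg : π.map (fun x => -x k) = gaussianReal (-m k) (v k) := by
    rw [← gaussianReal_map_neg, ← hev k]
    exact (Measure.map_map measurable_neg (measurable_pi_apply k)).symm
  have h := gaussianReal_add_gaussianReal_of_indepFun
    (((hind.indepFun hik).comp measurable_id measurable_neg)) (hev i) hneg
  rw [sub_eq_add_neg, ← h]
  rfl

lemma pi_gaussianReal_tie {i k : ι} (hik : i ≠ k) (hv : v i ≠ 0) :
    (Measure.pi fun j => gaussianReal (m j) (v j)) {x | x i = x k} = 0 := by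
  have hmeas : Measurable fun x : ι → ℝ => x i - x k :=
    (measurable_pi_apply i).sub (measurable_pi_apply k)
  have hset : {x : ι → ℝ | x i = x k} = (fun x => x i - x k) ⁻¹' {0} := by
    ext x; simp [sub_eq_zero]
  rw [hset, ← Measure.map_apply hmeas (measurableSet_singleton 0), pi_gaussianReal_map_sub m hik]
  have := nullSingletonClass_gaussianReal (μ := m i - m k)
    (show v i + v k ≠ 0 from fun h => hv (add_eq_zero.1 h).1)
  exact measure_singleton 0

lemma pi_gaussianReal_argmax_eq_strict (hv : ∀ i, v i ≠ 0) (i : ι) :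
    (Measure.pi fun j => gaussianReal (m j) (v j)).real {x | ∀ k, x k ≤ x i} =
      (Measure.pi fun j => gaussianReal (m j) (v j)).real {x | ∀ k, k ≠ i → x k < x i} := by
  refine measureReal_congr ?_
  have htie : ∀ᵐ x ∂(Measure.pi fun j => gaussianReal (m j) (v j)), ∀ k, k ≠ i → x i ≠ x k := by
    refine ae_all_iff.2 fun k => ?_
    by_cases hk : k = i
    · simp [hk]
    · filter_upwards [measure_eq_zero_iff_ae_notMem.1
        (pi_gaussianReal_tie m (Ne.symm hk) (hv i))] with x hx _ using hx
  filter_upwards [htie] with x hx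
  refine propext ⟨fun h k hk => lt_of_le_of_ne (h k) (hx k hk).symm, fun h k => ?_⟩
  by_cases hk : k = i
  · rw [hk]
  · exact (h k hk).le

lemma pi_gaussianReal_argmax_le (hv : ∀ i, v i ≠ 0) {i k : ι} (hik : i ≠ k) (hm : m i ≤ m k) :
    (Measure.pi fun j => gaussianReal (m j) (v j)).real {x | ∀ k, x k ≤ x i} ≤
      Real.exp (-(m k - m i) ^ 2 / (2 * (v i + v k))) := by
  have hmeas : Measurable fun x : ι → ℝ => x i - x k :=
    (measurable_pi_apply i).sub (measurable_pi_apply k)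
  calc (Measure.pi fun j => gaussianReal (m j) (v j)).real {x | ∀ k, x k ≤ x i}
      ≤ (Measure.pi fun j => gaussianReal (m j) (v j)).real
          ((fun x => x i - x k) ⁻¹' Set.Ici 0) :=
        measureReal_mono fun x hx => sub_nonneg.2 (hx k)
    _ = (gaussianReal (m i - m k) (v i + v k)).real (Set.Ici 0) := by
        rw [← pi_gaussianReal_map_sub m hik, map_measureReal_apply hmeas measurableSet_Ici]
    _ ≤ _ := by
        have h := gaussianReal_Ici_le (m := m i - m k) (c := 0) (v := v i + v k)
          (fun h => hv i (add_eq_zero.1 h).1) (sub_nonpos.2 hm)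
        rw [zero_sub, neg_sub, NNReal.coe_add] at h
        exact h

/-- If all variances are at most one, and all means are below `c` by at least one, then coordinate
`i` is the largest with a probability that is at least a constant times the one that it
exceeds `c`. -/
lemma le_pi_gaussianReal_argmax (hv : ∀ i, v i ≠ 0) (hv1 : ∀ i, v i ≤ 1) {c : ℝ}
    (hc : ∀ k, m k + 1 ≤ c) (i : ι) :
    (gaussianReal (m i) (v i)).real (Set.Ici c) * (1 - Real.exp (-1 / 2)) ^ Fintype.card ι ≤
      (Measure.pi fun j => gaussianReal (m j) (v j)).real {x | ∀ k, x k ≤ x i} := by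
  classical
  set r := 1 - Real.exp (-1 / 2) with hr
  have hr0 : 0 ≤ r := by
    have : Real.exp (-1 / 2) ≤ 1 := Real.exp_le_one_iff.2 (by norm_num)
    linarith
  have hr1 : r ≤ 1 := by linarith [Real.exp_pos (-1 / 2)]
  have hk : ∀ k, r ≤ (gaussianReal (m k) (v k)).real (Set.Iio c) := fun k => by
    have h1 := gaussianReal_Ici_le (hv k) (by linarith [hc k] : m k ≤ c)
    have h2 : (gaussianReal (m k) (v k)).real (Set.Iio c) =
        1 - (gaussianReal (m k) (v k)).real (Set.Ici c) := by
      rw [← Set.compl_Ici, probReal_compl_eq_one_sub measurableSet_Ici]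
    have hvk : (0 : ℝ) < v k := NNReal.coe_pos.2 (pos_iff_ne_zero.2 (hv k))
    have hvk1 : (v k : ℝ) ≤ 1 := NNReal.coe_le_one.2 (hv1 k)
    have h3 : Real.exp (-(c - m k) ^ 2 / (2 * v k)) ≤ Real.exp (-1 / 2) := by
      refine Real.exp_le_exp.2 ?_
      rw [div_le_div_iff₀ (by positivity) two_pos]
      nlinarith [hc k]
    rw [h2]; linarith
  set S : ι → Set ℝ := fun k => if k = i then Set.Ici c else Set.Iio c with hS
  have hsub : Set.pi Set.univ S ⊆ {x | ∀ k, x k ≤ x i} := fun x hx k => by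
    have hi : c ≤ x i := by simpa [hS] using hx i trivial
    by_cases h : k = i
    · rw [h]
    · have hxk : x k < c := by simpa [hS, h] using hx k trivial
      exact hxk.le.trans hi
  refine le_trans ?_ (measureReal_mono hsub)
  have hpi : (Measure.pi fun j => gaussianReal (m j) (v j)).real (Set.pi Set.univ S) =
      ∏ k, (gaussianReal (m k) (v k)).real (S k) := by
    simp_rw [measureReal_def]
    rw [Measure.pi_pi, ENNReal.toReal_prod]
  rw [hpi, ← Finset.mul_prod_erase _ _ (Finset.mem_univ i)]
  have hSi : S i = Set.Ici c := by simp [hS]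
  rw [hSi]
  refine mul_le_mul_of_nonneg_left ?_ measureReal_nonneg
  calc r ^ Fintype.card ι ≤ r ^ (Finset.univ.erase i).card :=
        pow_le_pow_of_le_one hr0 hr1 (Finset.card_le_univ _)
    _ = ∏ _k ∈ Finset.univ.erase i, r := by rw [Finset.prod_const]
    _ ≤ _ := by
      refine Finset.prod_le_prod (fun _ _ => hr0) fun k hki => ?_
      have : S k = Set.Iio c := by simp [hS, Finset.ne_of_mem_erase hki]
      rw [this]
      exact hk k

end Pi

/-! ### Posteriors, selection probabilities and batches of a single trajectory -/

section Path

variable {I : ℕ} (a : ℕ → Fin I) (y : ℕ → Fin I → ℝ)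

lemma pulls_eq_sum (i : Fin I) (n : ℕ) :
    (pulls a i n : ℝ) = ∑ t ∈ Finset.range n, if a t = i then (1 : ℝ) else 0 := by
  rw [pulls, Finset.card_filter]
  push_cast
  rfl

lemma pulls_mono (i : Fin I) : Monotone (pulls a i) := fun _ _ h =>
  Finset.card_le_card (Finset.filter_subset_filter _ (Finset.range_mono h))

lemma sum_pulls (n : ℕ) : ∑ i, (pulls a i n : ℝ) = n := by
  simp_rw [pulls_eq_sum]
  rw [Finset.sum_comm]
  simp

lemma postVar_ne_zero (n : ℕ) (i : Fin I) : postVar a n i ≠ 0 :=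
  div_ne_zero one_ne_zero (by positivity)

lemma postVar_le_one (n : ℕ) (i : Fin I) : postVar a n i ≤ 1 := by
  rw [postVar]
  exact div_le_one_of_le₀ (le_add_of_nonneg_right zero_le) (by positivity)

lemma coe_postVar (n : ℕ) (i : Fin I) : (postVar a n i : ℝ) = 1 / (1 + (pulls a i n : ℝ)) := by
  simp [postVar]

instance isProbabilityMeasure_posterior (n : ℕ) : IsProbabilityMeasure (posterior a y n) := by
  unfold posterior
  infer_instance

lemma selProb_le_one (n : ℕ) (i : Fin I) : selProb a y n i ≤ 1 := measureReal_le_one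

lemma le_selProb (n : ℕ) {c : ℝ} (hc : ∀ k, postMean a y n k + 1 ≤ c) (i : Fin I) :
    (gaussianReal (postMean a y n i) (postVar a n i)).real (Set.Ici c) *
      (1 - Real.exp (-1 / 2)) ^ I ≤ selProb a y n i := by
  have h := le_pi_gaussianReal_argmax (postMean a y n) (postVar_ne_zero a n) (postVar_le_one a n)
    hc i
  rwa [Fintype.card_fin] at h

lemma one_sub_exp_neg_half_pos : 0 < 1 - Real.exp (-1 / 2) :=
  sub_pos.2 (Real.exp_lt_one_iff.2 (by norm_num))

lemma selProb_pos (n : ℕ) (i : Fin I) : 0 < selProb a y n i := by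
  obtain ⟨c, hc⟩ := (Set.finite_range fun k => postMean a y n k + 1).bddAbove
  refine lt_of_lt_of_le (mul_pos (gaussianReal_Ici_pos _ c (postVar_ne_zero a n i))
    (pow_pos one_sub_exp_neg_half_pos I)) (le_selProb a y n (fun k => hc ⟨k, rfl⟩) i)

lemma selProb_le_exp (n : ℕ) {i k : Fin I} (hik : i ≠ k)
    (hm : postMean a y n i ≤ postMean a y n k) :
    selProb a y n i ≤ Real.exp (-(postMean a y n k - postMean a y n i) ^ 2 /
      (2 * (1 / (1 + (pulls a i n : ℝ)) + 1 / (1 + (pulls a k n : ℝ))))) := by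
  have h := pi_gaussianReal_argmax_le (postMean a y n) (postVar_ne_zero a n) hik hm
  rwa [coe_postVar, coe_postVar] at h

lemma one_le_sum_selProb (hI : 2 ≤ I) (n : ℕ) : 1 ≤ ∑ i, selProb a y n i := by
  have : Nonempty (Fin I) := ⟨⟨0, by omega⟩⟩
  have hcover : (⋃ i, {x : Fin I → ℝ | ∀ k, x k ≤ x i}) = Set.univ := by
    refine Set.eq_univ_of_forall fun x => ?_
    obtain ⟨i, hi⟩ := Finite.exists_max x
    exact Set.mem_iUnion.2 ⟨i, hi⟩
  calc (1 : ℝ) = (posterior a y n).real (⋃ i, {x : Fin I → ℝ | ∀ k, x k ≤ x i}) := by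
        rw [hcover, probReal_univ]
    _ ≤ ∑ i, selProb a y n i := measureReal_iUnion_fintype_le _

lemma min_le_secondLargest (p : Fin I → ℝ) {i k : Fin I} (hik : i ≠ k) :
    min (p i) (p k) ≤ secondLargest p :=
  le_ciSup (f := fun q : {q : Fin I × Fin I // q.1 ≠ q.2} => min (p q.1.1) (p q.1.2))
    (Set.finite_range _).bddAbove ⟨(i, k), hik⟩

lemma exists_secondLargest_eq (hI : 2 ≤ I) (p : Fin I → ℝ) :
    ∃ i k, i ≠ k ∧ secondLargest p = min (p i) (p k) := by
  have : Nonempty {q : Fin I × Fin I // q.1 ≠ q.2} :=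
    ⟨⟨(⟨0, by omega⟩, ⟨1, by omega⟩), by simp⟩⟩
  obtain ⟨q, hq⟩ := exists_eq_ciSup_of_finite
    (f := fun q : {q : Fin I × Fin I // q.1 ≠ q.2} => min (p q.1.1) (p q.1.2))
  exact ⟨q.1.1, q.1.2, q.2, hq.symm⟩

lemma secondLargest_selProb_pos (hI : 2 ≤ I) (n : ℕ) : 0 < secondLargest (selProb a y n) := by
  obtain ⟨i, k, -, h⟩ := exists_secondLargest_eq hI (selProb a y n)
  rw [h]
  exact lt_min (selProb_pos a y n i) (selProb_pos a y n k)

lemma secondLargest_selProb_le_one (hI : 2 ≤ I) (n : ℕ) : secondLargest (selProb a y n) ≤ 1 := by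
  obtain ⟨i, k, -, h⟩ := exists_secondLargest_eq hI (selProb a y n)
  rw [h]
  exact (min_le_left _ _).trans (selProb_le_one a y n i)

/-- Whichever arm is taken out, the probabilities of the others sum to at least the second
largest one. -/
lemma secondLargest_le_sum_erase (hI : 2 ≤ I) (n : ℕ) (b : Fin I) :
    secondLargest (selProb a y n) ≤ ∑ i ∈ Finset.univ.erase b, selProb a y n i := by
  obtain ⟨i, k, hik, h⟩ := exists_secondLargest_eq hI (selProb a y n)
  have hle : ∀ j, j ≠ b → selProb a y n j ≤ ∑ i ∈ Finset.univ.erase b, selProb a y n i :=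
    fun j hj => Finset.single_le_sum (f := fun i => selProb a y n i)
      (fun i _ => (selProb_pos a y n i).le) (Finset.mem_erase.2 ⟨hj, Finset.mem_univ j⟩)
  rw [h]
  by_cases hib : i = b
  · exact (min_le_right _ _).trans (hle k fun hkb => hik (hib.trans hkb.symm))
  · exact (min_le_left _ _).trans (hle i hib)

lemma batchEnd_strictMono (hI : 2 ≤ I) : StrictMono (batchEnd a y) := by
  refine strictMono_nat_of_lt_succ fun j => ?_
  rw [batchEnd]
  refine Nat.lt_add_of_pos_right (Nat.floor_pos.2 ?_)
  rw [le_div_iff₀ (secondLargest_selProb_pos a y hI _), one_mul]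
  exact secondLargest_selProb_le_one a y hI _

/-- The supremum in the definition of `completedBatches` is attained. -/
lemma le_completedBatches_iff (hI : 2 ≤ I) {j n : ℕ} :
    j ≤ completedBatches a y n ↔ batchEnd a y j ≤ n := by
  have hbdd : BddAbove {j | batchEnd a y j ≤ n} :=
    ⟨n, fun j hj => ((batchEnd_strictMono a y hI).le_apply).trans hj⟩
  have hne : {j | batchEnd a y j ≤ n}.Nonempty := ⟨0, by simp [batchEnd]⟩
  refine ⟨fun h => ?_, fun h => le_csSup hbdd h⟩
  exact ((batchEnd_strictMono a y hI).monotone h).trans (Nat.sSup_mem hne hbdd)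

/-- The number of rounds whose feedback is known to the agent at index `t`, which is the start of
the batch that contains index `t`. -/
noncomputable def batchStart (t : ℕ) : ℕ := batchEnd a y (completedBatches a y t)

lemma batchStart_eq (hI : 2 ≤ I) {j t : ℕ} (h1 : batchEnd a y j ≤ t)
    (h2 : t < batchEnd a y (j + 1)) : batchStart a y t = batchEnd a y j := by
  have h3 : j ≤ completedBatches a y t := (le_completedBatches_iff a y hI).2 h1
  have h4 : ¬ j + 1 ≤ completedBatches a y t := fun h =>
    absurd ((le_completedBatches_iff a y hI).1 h) (not_le.2 h2)
  rw [batchStart, show completedBatches a y t = j by omega]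

lemma le_batchStart (hI : 2 ≤ I) {j t : ℕ} (h : batchEnd a y j ≤ t) :
    batchEnd a y j ≤ batchStart a y t :=
  (batchEnd_strictMono a y hI).monotone ((le_completedBatches_iff a y hI).2 h)

lemma tendsto_batchStart (hI : 2 ≤ I) : Tendsto (batchStart a y) atTop atTop := by
  refine tendsto_atTop.2 fun j => ?_
  filter_upwards [eventually_ge_atTop (batchEnd a y j)] with t ht
  exact ((batchEnd_strictMono a y hI).le_apply).trans (le_batchStart a y hI ht)

lemma tendsto_completedBatches (hI : 2 ≤ I) : Tendsto (completedBatches a y) atTop atTop := by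
  refine tendsto_atTop.2 fun j => ?_
  filter_upwards [eventually_ge_atTop (batchEnd a y j)] with t ht
  exact (le_completedBatches_iff a y hI).2 ht

lemma batch_length_mul_le_one (hI : 2 ≤ I) (j : ℕ) :
    ((batchEnd a y (j + 1) - batchEnd a y j : ℕ) : ℝ) *
      secondLargest (selProb a y (batchEnd a y j)) ≤ 1 := by
  have hpos := secondLargest_selProb_pos a y hI (batchEnd a y j)
  rw [batchEnd, Nat.add_sub_cancel_left, ← le_div_iff₀ hpos]
  exact Nat.floor_le (by positivity)

lemma one_sub_le_batch_length_mul (hI : 2 ≤ I) (j : ℕ) :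
    1 - secondLargest (selProb a y (batchEnd a y j)) ≤
      ((batchEnd a y (j + 1) - batchEnd a y j : ℕ) : ℝ) *
        secondLargest (selProb a y (batchEnd a y j)) := by
  have hpos := secondLargest_selProb_pos a y hI (batchEnd a y j)
  rw [batchEnd, Nat.add_sub_cancel_left]
  set p := secondLargest (selProb a y (batchEnd a y j))
  have h := (Nat.sub_one_lt_floor (1 / p)).le
  calc 1 - p = (1 / p - 1) * p := by field_simp
    _ ≤ _ := mul_le_mul_of_nonneg_right h hpos.le

/-- Suppose that the selection probability of a suboptimal arm `i` decays exponentially in the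
number of its pulls, and let `s` be the start of the last batch that begins with fewer than
`log T / κ` pulls of arm `i`.  From then until `T`, the selection probabilities of arm `i` sum to at
most two: one for the batch that begins at `s`, by the rule for the batch lengths, and one for the
rounds after that batch, each of which has probability at most `1 / T`. -/
lemma eventually_exists_sum_selProb_le_two (hI : 2 ≤ I) {i b : Fin I} (hib : i ≠ b) {κ : ℝ}
    (hκ : 0 < κ) (hexp : ∀ᶠ n in atTop, selProb a y n i ≤ Real.exp (-(κ * pulls a i n)))
    (hb : ∀ᶠ n in atTop, selProb a y n i ≤ selProb a y n b) :
    ∀ᶠ T : ℕ in atTop, ∃ s ≤ T, (pulls a i s : ℝ) ≤ Real.log T / κ ∧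
      ∑ t ∈ Finset.Ico s T, selProb a y (batchStart a y t) i ≤ 2 := by
  obtain ⟨j₀, hj₀⟩ := eventually_atTop.1 (hexp.and hb)
  have hmono := (batchEnd_strictMono a y hI).monotone
  have hlarge : ∀ j, j₀ ≤ j → j₀ ≤ batchEnd a y j := fun j hj =>
    hj.trans (batchEnd_strictMono a y hI).le_apply
  have hlog : Tendsto (fun T : ℕ => Real.log T / κ) atTop atTop :=
    (Real.tendsto_log_atTop.comp tendsto_natCast_atTop_atTop).atTop_div_const hκ
  filter_upwards [eventually_ge_atTop (batchEnd a y j₀), eventually_gt_atTop 0,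
    hlog.eventually_gt_atTop (pulls a i (batchEnd a y j₀) : ℝ)] with T hT hT0 hTlog
  have hT0' : (0 : ℝ) < T := Nat.cast_pos.2 hT0
  classical
  set p : ℕ → Prop := fun j => (pulls a i (batchEnd a y j) : ℝ) < Real.log T / κ with hp
  set j := Nat.findGreatest p (completedBatches a y T) with hj
  have hj₀T : j₀ ≤ completedBatches a y T := (le_completedBatches_iff a y hI).2 hT
  have hjp : p j := Nat.findGreatest_spec (P := p) hj₀T hTlog
  have hj₀j : j₀ ≤ j := Nat.le_findGreatest hj₀T hTlog
  have hjT : batchEnd a y j ≤ T :=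
    (le_completedBatches_iff a y hI).1 (Nat.findGreatest_le _)
  refine ⟨batchEnd a y j, hjT, hjp.le, ?_⟩
  have hterm : ∀ t ∈ Finset.Ico (batchEnd a y j) T, selProb a y (batchStart a y t) i ≤
      (if t ∈ Finset.Ico (batchEnd a y j) (batchEnd a y (j + 1)) then
        selProb a y (batchEnd a y j) i else 0) + 1 / T := by
    intro t ht
    obtain ⟨ht1, ht2⟩ := Finset.mem_Ico.1 ht
    by_cases htj : t < batchEnd a y (j + 1)
    · rw [if_pos (Finset.mem_Ico.2 ⟨ht1, htj⟩), batchStart_eq a y hI ht1 htj]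
      exact le_add_of_nonneg_right (by positivity)
    · rw [if_neg (fun h => htj (Finset.mem_Ico.1 h).2), zero_add]
      have hlt : j < completedBatches a y t :=
        (le_completedBatches_iff a y hI).2 (not_lt.1 htj)
      have hle : completedBatches a y t ≤ completedBatches a y T :=
        (le_completedBatches_iff a y hI).2
          (((le_completedBatches_iff a y hI).1 le_rfl).trans ht2.le)
      have hnp : ¬ p (completedBatches a y t) := Nat.findGreatest_is_greatest hlt hle
      have hnp' : Real.log T ≤ κ * pulls a i (batchStart a y t) := by
        rw [hp, not_lt, div_le_iff₀ hκ, mul_comm] at hnp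
        exact hnp
      refine ((hj₀ _ (hlarge _ (hj₀j.trans hlt.le))).1).trans ?_
      calc Real.exp (-(κ * pulls a i (batchStart a y t))) ≤ Real.exp (-Real.log T) :=
            Real.exp_le_exp.2 (neg_le_neg hnp')
        _ = 1 / T := by rw [Real.exp_neg, Real.exp_log hT0', one_div]
  have hmin : selProb a y (batchEnd a y j) i ≤ secondLargest (selProb a y (batchEnd a y j)) := by
    have h := min_le_secondLargest (selProb a y (batchEnd a y j)) hib
    rwa [min_eq_left (hj₀ _ (hlarge j hj₀j)).2] at h
  calc ∑ t ∈ Finset.Ico (batchEnd a y j) T, selProb a y (batchStart a y t) i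
      ≤ ∑ t ∈ Finset.Ico (batchEnd a y j) T,
        ((if t ∈ Finset.Ico (batchEnd a y j) (batchEnd a y (j + 1)) then
          selProb a y (batchEnd a y j) i else 0) + 1 / T) := Finset.sum_le_sum hterm
    _ ≤ (batchEnd a y (j + 1) - batchEnd a y j : ℕ) * selProb a y (batchEnd a y j) i +
        (T - batchEnd a y j : ℕ) * (1 / T) := by
      rw [Finset.sum_add_distrib, ← Finset.sum_filter, Finset.sum_const, Finset.sum_const,
        nsmul_eq_mul, nsmul_eq_mul, Nat.card_Ico]
      refine add_le_add (mul_le_mul_of_nonneg_right ?_ (selProb_pos a y _ i).le) le_rfl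
      rw [← Nat.card_Ico]
      exact Nat.cast_le.2 (Finset.card_le_card fun t ht => (Finset.mem_filter.1 ht).2)
    _ ≤ 1 + 1 := by
      refine add_le_add ?_ ?_
      · exact (mul_le_mul_of_nonneg_left hmin (Nat.cast_nonneg _)).trans
          (batch_length_mul_le_one a y hI j)
      · rw [mul_one_div, div_le_one hT0']
        exact Nat.cast_le.2 (Nat.sub_le _ _)
    _ = 2 := by norm_num

/-- Once the suboptimal arms have small selection probabilities, every batch contributes almost one
to their sum, because the length of a batch is about the inverse of the second largest selection
probability. -/
lemma exists_completedBatches_le_sum_selProb (hI : 2 ≤ I) (b : Fin I)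
    (h0 : ∀ i, i ≠ b → Tendsto (fun n => selProb a y n i) atTop (𝓝 0)) {ε : ℝ} (hε : 0 < ε) :
    ∃ C : ℝ, ∀ n, (1 - ε) * completedBatches a y n ≤ C +
      ∑ t ∈ Finset.range n, ∑ i ∈ Finset.univ.erase b, selProb a y (batchStart a y t) i := by
  set q : ℕ → ℝ := fun n => ∑ i ∈ Finset.univ.erase b, selProb a y n i with hq
  have hq0 : ∀ n, 0 ≤ q n := fun n => Finset.sum_nonneg fun i _ => (selProb_pos a y n i).le
  have hqlim : Tendsto q atTop (𝓝 0) := by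
    have := tendsto_finsetSum (Finset.univ.erase b) fun i hi => h0 i (Finset.ne_of_mem_erase hi)
    simpa [hq] using this
  obtain ⟨j₀, hj₀⟩ := eventually_atTop.1 (hqlim.eventually_le_const hε)
  have hbatch : ∀ j, ∑ t ∈ Finset.range (batchEnd a y j), q (batchStart a y t) ≥
      (1 - ε) * j - |1 - ε| * j₀ := by
    intro j
    induction j with
    | zero =>
      simp only [batchEnd, Finset.range_zero, Finset.sum_empty, Nat.cast_zero, mul_zero, zero_sub]
      exact neg_nonpos.2 (by positivity)
    | succ j ih =>
      have hle := (batchEnd_strictMono a y hI).monotone j.le_succ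
      rw [← Finset.sum_range_add_sum_Ico _ hle]
      have hconst : ∑ t ∈ Finset.Ico (batchEnd a y j) (batchEnd a y (j + 1)),
          q (batchStart a y t) =
            (batchEnd a y (j + 1) - batchEnd a y j : ℕ) * q (batchEnd a y j) := by
        rw [← Nat.card_Ico, ← nsmul_eq_mul, ← Finset.sum_const]
        refine Finset.sum_congr rfl fun t ht => ?_
        rw [batchStart_eq a y hI (Finset.mem_Ico.1 ht).1 (Finset.mem_Ico.1 ht).2]
      rw [hconst]
      have hsec := secondLargest_le_sum_erase a y hI (batchEnd a y j) b
      have hlen := mul_le_mul_of_nonneg_left hsec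
        (Nat.cast_nonneg (α := ℝ) (batchEnd a y (j + 1) - batchEnd a y j))
      have hone := one_sub_le_batch_length_mul a y hI j
      rcases le_or_gt j₀ j with hj | hj
      · have h1 : q (batchEnd a y j) ≤ ε :=
          hj₀ _ (hj.trans (batchEnd_strictMono a y hI).le_apply)
        push_cast at ih ⊢
        simp only [hq] at h1 hlen ih ⊢
        linarith
      · have h2 : 0 ≤ (batchEnd a y (j + 1) - batchEnd a y j : ℕ) * q (batchEnd a y j) :=
          mul_nonneg (Nat.cast_nonneg _) (hq0 _)
        have h3 : 0 ≤ ∑ t ∈ Finset.range (batchEnd a y j), q (batchStart a y t) :=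
          Finset.sum_nonneg fun t _ => hq0 _
        have h4 : (1 - ε) * ((j + 1 : ℕ) : ℝ) ≤ |1 - ε| * j₀ :=
          mul_le_mul (le_abs_self _) (Nat.cast_le.2 hj) (Nat.cast_nonneg _) (abs_nonneg _)
        linarith
  refine ⟨|1 - ε| * j₀, fun n => ?_⟩
  have h1 := hbatch (completedBatches a y n)
  have h2 : ∑ t ∈ Finset.range (batchEnd a y (completedBatches a y n)), q (batchStart a y t) ≤
      ∑ t ∈ Finset.range n, q (batchStart a y t) :=
    Finset.sum_le_sum_of_subset_of_nonneg
      (Finset.range_mono ((le_completedBatches_iff a y hI).1 le_rfl)) fun t _ _ => hq0 _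
  linarith

end Path

/-! ### Asymptotics of a single trajectory -/

section Path

variable {I : ℕ} (a : ℕ → Fin I) (y : ℕ → Fin I → ℝ)

lemma tendsto_pulls_of_not_bounded {i : Fin I} (h : ¬ ∃ C, ∀ n, pulls a i n ≤ C) :
    Tendsto (pulls a i) atTop atTop := by
  refine tendsto_atTop_atTop_of_monotone (pulls_mono a i) fun C => ?_
  by_contra! hC
  exact h ⟨C, fun n => (hC n).le⟩

/-- If arm `i` is pulled only finitely often then everything about its posterior is eventually
constant. -/
lemma eventually_posterior_const {i : Fin I} (h : ∃ C, ∀ n, pulls a i n ≤ C) :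
    ∃ n₀, ∀ n ≥ n₀, postMean a y n i = postMean a y n₀ i ∧ postVar a n i = postVar a n₀ i := by
  obtain ⟨C, hC⟩ := h
  obtain ⟨n₀, hn₀⟩ : ∃ n₀, ∀ n ≥ n₀, pulls a i n = pulls a i n₀ := by
    obtain ⟨n₀, hn₀⟩ := Nat.sSup_mem (Set.range_nonempty (pulls a i))
      ⟨C, Set.forall_mem_range.2 hC⟩
    refine ⟨n₀, fun n hn => le_antisymm ?_ (pulls_mono a i hn)⟩
    rw [hn₀]
    exact le_csSup ⟨C, Set.forall_mem_range.2 hC⟩ ⟨n, rfl⟩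
  refine ⟨n₀, fun n hn => ?_⟩
  have hset : (Finset.range n).filter (fun t => a t = i) =
      (Finset.range n₀).filter (fun t => a t = i) :=
    (Finset.eq_of_subset_of_card_le
      (Finset.filter_subset_filter _ (Finset.range_mono hn)) (hn₀ n hn).le).symm
  simp only [postMean, postVar, hn₀ n hn, hset, and_self]

/-- The centred rewards of arm `i` being negligible with respect to the number of pulls makes the
posterior mean consistent. -/
lemma tendsto_postMean {i : Fin I} {m : ℝ} (hN : Tendsto (pulls a i) atTop atTop)
    (h : Tendsto (fun n => (∑ t ∈ Finset.range n, (if a t = i then 1 else 0) * (y t i - m)) /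
      (1 + (pulls a i n : ℝ))) atTop (𝓝 0)) :
    Tendsto (fun n => postMean a y n i) atTop (𝓝 m) := by
  have hN' : Tendsto (fun n => 1 + (pulls a i n : ℝ)) atTop atTop :=
    tendsto_atTop_add_const_left _ 1 (tendsto_natCast_atTop_atTop.comp hN)
  have h1 : Tendsto (fun n => (∑ t ∈ Finset.range n, (if a t = i then 1 else 0) * (y t i - m)) /
      (1 + (pulls a i n : ℝ)) + (m - m / (1 + (pulls a i n : ℝ)))) atTop (𝓝 m) := by
    simpa using h.add ((hN'.const_div_atTop m).const_sub m)
  refine h1.congr fun n => ?_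
  have hpos : (0 : ℝ) < 1 + pulls a i n := by positivity
  have hsum : ∑ t ∈ Finset.range n, (if a t = i then 1 else 0) * (y t i - m) =
      (∑ t ∈ (Finset.range n).filter (fun t => a t = i), y t i) - m * pulls a i n := by
    rw [pulls_eq_sum, Finset.sum_filter, Finset.mul_sum, ← Finset.sum_sub_distrib]
    refine Finset.sum_congr rfl fun t _ => ?_
    split_ifs <;> ring
  rw [hsum, postMean]
  field_simp
  ring

lemma exists_bound_of_tendsto {x : ℕ → ℝ} {c : ℝ} (h : Tendsto x atTop (𝓝 c)) :
    ∃ M, ∀ n, |x n| ≤ M := by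
  obtain ⟨M, hM⟩ := (Metric.isBounded_range_of_tendsto x h).exists_norm_le
  exact ⟨M, fun n => hM _ ⟨n, rfl⟩⟩

/-- Every arm is pulled infinitely often if this is so for every arm whose selection probabilities
have an infinite sum: the posterior of an arm that is abandoned is eventually constant, so its
selection probability stays away from zero. -/
lemma tendsto_pulls (hI : 2 ≤ I) {μ : Fin I → ℝ}
    (hmean : ∀ i, Tendsto (pulls a i) atTop atTop →
      Tendsto (fun n => postMean a y n i) atTop (𝓝 (μ i)))
    (hcount : ∀ i, Tendsto (fun n => ∑ t ∈ Finset.range n, selProb a y (batchStart a y t) i)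
      atTop atTop → Tendsto (pulls a i) atTop atTop) (i : Fin I) :
    Tendsto (pulls a i) atTop atTop := by
  by_contra hi
  have hbdd : ∃ C, ∀ n, pulls a i n ≤ C := by
    by_contra h
    exact hi (tendsto_pulls_of_not_bounded a h)
  have hM : ∀ k, ∃ M, ∀ n, |postMean a y n k| ≤ M := fun k => by
    by_cases hk : Tendsto (pulls a k) atTop atTop
    · exact exists_bound_of_tendsto (hmean k hk)
    · have hkb : ∃ C, ∀ n, pulls a k n ≤ C := by
        by_contra h
        exact hk (tendsto_pulls_of_not_bounded a h)
      obtain ⟨n₀, hn₀⟩ := eventually_posterior_const a y hkb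
      exact exists_bound_of_tendsto (tendsto_const_nhds.congr' <|
        (eventually_ge_atTop n₀).mono fun n hn => (hn₀ n hn).1.symm)
  choose M hM using hM
  obtain ⟨n₀, hn₀⟩ := eventually_posterior_const a y hbdd
  obtain ⟨c, hc⟩ := (Set.finite_range fun k => M k + 1).bddAbove
  set δ := (gaussianReal (postMean a y n₀ i) (postVar a n₀ i)).real (Set.Ici c) *
    (1 - Real.exp (-1 / 2)) ^ I with hδ
  have hδ0 : 0 < δ := mul_pos (gaussianReal_Ici_pos _ c (postVar_ne_zero a n₀ i))
    (pow_pos one_sub_exp_neg_half_pos I)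
  have hsel : ∀ n ≥ n₀, δ ≤ selProb a y n i := fun n hn => by
    have h := le_selProb a y n (c := c) (fun k =>
      (add_le_add_left ((le_abs_self _).trans (hM k n)) 1).trans (hc ⟨k, rfl⟩)) i
    rwa [(hn₀ n hn).1, (hn₀ n hn).2] at h
  obtain ⟨t₀, ht₀⟩ := eventually_atTop.1 ((tendsto_batchStart a y hI).eventually_ge_atTop n₀)
  refine hi (hcount i ?_)
  have hlin : Tendsto (fun n : ℕ => ((n : ℝ) - t₀) * δ) atTop atTop :=
    (tendsto_atTop_add_const_right _ (-(t₀ : ℝ)) tendsto_natCast_atTop_atTop).atTop_mul_const hδ0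
  refine tendsto_atTop_mono' _ ?_ hlin
  filter_upwards [eventually_ge_atTop t₀] with n hn
  calc ((n : ℝ) - t₀) * δ = ∑ _t ∈ Finset.Ico t₀ n, δ := by
        rw [Finset.sum_const, Nat.card_Ico, nsmul_eq_mul, Nat.cast_sub hn]
    _ ≤ ∑ t ∈ Finset.Ico t₀ n, selProb a y (batchStart a y t) i :=
        Finset.sum_le_sum fun t ht => hsel _ (ht₀ t (Finset.mem_Ico.1 ht).1)
    _ ≤ ∑ t ∈ Finset.range n, selProb a y (batchStart a y t) i := by
        rw [← Finset.sum_range_add_sum_Ico _ hn]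
        exact le_add_of_nonneg_left (Finset.sum_nonneg fun t _ => (selProb_pos a y _ i).le)

variable {a y} {μ : Fin I → ℝ} {i b : Fin I}

lemma eventually_postMean_le (hμ : μ i < μ b)
    (hmi : Tendsto (fun n => postMean a y n i) atTop (𝓝 (μ i)))
    (hmb : Tendsto (fun n => postMean a y n b) atTop (𝓝 (μ b))) :
    ∀ᶠ n in atTop, postMean a y n i ≤ postMean a y n b :=
  (hmi.eventually_lt hmb hμ).mono fun _ h => h.le

lemma tendsto_selProb_zero (hib : i ≠ b) (hμ : μ i < μ b)
    (hi : Tendsto (pulls a i) atTop atTop) (hb : Tendsto (pulls a b) atTop atTop)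
    (hmi : Tendsto (fun n => postMean a y n i) atTop (𝓝 (μ i)))
    (hmb : Tendsto (fun n => postMean a y n b) atTop (𝓝 (μ b))) :
    Tendsto (fun n => selProb a y n i) atTop (𝓝 0) := by
  have hN : ∀ k, Tendsto (pulls a k) atTop atTop →
      Tendsto (fun n => 1 / (1 + (pulls a k n : ℝ))) atTop (𝓝 0) := fun k hk =>
    (tendsto_atTop_add_const_left _ 1 (tendsto_natCast_atTop_atTop.comp hk)).const_div_atTop 1
  have hv : Tendsto (fun n => 2 * (1 / (1 + (pulls a i n : ℝ)) + 1 / (1 + (pulls a b n : ℝ))))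
      atTop (𝓝[>] 0) := by
    refine tendsto_nhdsWithin_iff.2 ⟨by simpa using ((hN i hi).add (hN b hb)).const_mul 2,
      Eventually.of_forall fun n => ?_⟩
    simp only [Set.mem_Ioi]
    positivity
  have hd : Tendsto (fun n => (postMean a y n b - postMean a y n i) ^ 2) atTop
      (𝓝 ((μ b - μ i) ^ 2)) := (hmb.sub hmi).pow 2
  have hquot : Tendsto (fun n => -(postMean a y n b - postMean a y n i) ^ 2 /
      (2 * (1 / (1 + (pulls a i n : ℝ)) + 1 / (1 + (pulls a b n : ℝ))))) atTop atBot := by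
    exact (hd.neg.neg_mul_atTop (neg_lt_zero.2 (pow_pos (sub_pos.2 hμ) 2))
      (tendsto_inv_nhdsGT_zero.comp hv)).congr fun n => (div_eq_mul_inv _ _).symm
  refine squeeze_zero' (Eventually.of_forall fun n => (selProb_pos a y n i).le) ?_
    (Real.tendsto_exp_atBot.comp hquot)
  filter_upwards [eventually_postMean_le hμ hmi hmb] with n hn
  exact selProb_le_exp a y n hib hn

/-- When the pulls of a suboptimal arm are negligible with respect to those of the best one, the
variance of the best arm does not matter, and the selection probability decays at any rate below
`Δ ^ 2 / 2` per pull. -/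
lemma eventually_selProb_le_exp (hib : i ≠ b) (hμ : μ i < μ b)
    (hmi : Tendsto (fun n => postMean a y n i) atTop (𝓝 (μ i)))
    (hmb : Tendsto (fun n => postMean a y n b) atTop (𝓝 (μ b)))
    (hratio : Tendsto (fun n => (1 + (pulls a i n : ℝ)) / (1 + (pulls a b n : ℝ))) atTop (𝓝 0))
    {κ : ℝ} (hκ0 : 0 ≤ κ) (hκ : κ < (μ b - μ i) ^ 2 / 2) :
    ∀ᶠ n in atTop, selProb a y n i ≤ Real.exp (-(κ * pulls a i n)) := by
  have hlim : Tendsto (fun n => (postMean a y n b - postMean a y n i) ^ 2 /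
      (2 * (1 + (1 + (pulls a i n : ℝ)) / (1 + (pulls a b n : ℝ))))) atTop
      (𝓝 ((μ b - μ i) ^ 2 / 2)) := by
    have := ((hmb.sub hmi).pow 2).div ((hratio.const_add 1).const_mul 2) (by norm_num)
    rw [add_zero, mul_one] at this
    exact this
  filter_upwards [eventually_postMean_le hμ hmi hmb, hlim.eventually_const_le hκ] with n hn h
  refine (selProb_le_exp a y n hib hn).trans (Real.exp_le_exp.2 ?_)
  rw [neg_div, neg_le_neg_iff]
  have hi0 : (0 : ℝ) ≤ pulls a i n := Nat.cast_nonneg _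
  have hb0 : (0 : ℝ) ≤ pulls a b n := Nat.cast_nonneg _
  calc κ * pulls a i n ≤ κ * (1 + pulls a i n) :=
        mul_le_mul_of_nonneg_left (by linarith) hκ0
    _ ≤ (postMean a y n b - postMean a y n i) ^ 2 /
      (2 * (1 + (1 + (pulls a i n : ℝ)) / (1 + (pulls a b n : ℝ)))) * (1 + pulls a i n) :=
        mul_le_mul_of_nonneg_right h (by positivity)
    _ = _ := by field_simp

/-- If the windowed counts of a suboptimal arm exceed the sums of its selection probabilities at
most logarithmically, then its pulls are a vanishing fraction of the rounds. -/
lemma tendsto_pulls_div_zero (hI : 2 ≤ I)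
    (hsel : Tendsto (fun n => selProb a y n i) atTop (𝓝 0)) {c₁ c₂ : ℝ}
    (hcount : ∀ᶠ n : ℕ in atTop, (pulls a i n : ℝ) ≤
      c₁ * ∑ t ∈ Finset.range n, selProb a y (batchStart a y t) i + c₂ * Real.log (n + 1)) :
    Tendsto (fun n => (pulls a i n : ℝ) / n) atTop (𝓝 0) := by
  have hces := (hsel.comp (tendsto_batchStart a y hI)).cesaro
  have hlog : Tendsto (fun n : ℕ => Real.log ((n : ℝ) + 1) / n) atTop (𝓝 0) := by
    have h1 : Tendsto (fun x : ℝ => Real.log x / x) atTop (𝓝 0) :=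
      Real.isLittleO_log_id_atTop.tendsto_div_nhds_zero
    have h2 := h1.comp (tendsto_natCast_atTop_atTop.comp (tendsto_add_atTop_nat 1))
    have h3 : Tendsto (fun n : ℕ => ((n : ℝ) + 1) / n) atTop (𝓝 1) := by
      have h := (tendsto_const_div_atTop_nhds_zero_nat (1 : ℝ)).const_add 1
      rw [add_zero] at h
      refine h.congr' ((eventually_gt_atTop 0).mono fun n hn => ?_)
      have : (n : ℝ) ≠ 0 := Nat.cast_ne_zero.2 hn.ne'
      field_simp
    have h4 := h2.mul h3
    rw [zero_mul] at h4
    refine h4.congr' ?_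
    filter_upwards [eventually_gt_atTop 0] with n hn
    have : (n : ℝ) ≠ 0 := Nat.cast_ne_zero.2 hn.ne'
    simp only [Function.comp_apply]
    push_cast
    field_simp
  have hlim : Tendsto (fun n : ℕ => c₁ * ((n : ℝ)⁻¹ * ∑ t ∈ Finset.range n,
      selProb a y (batchStart a y t) i) + c₂ * (Real.log ((n : ℝ) + 1) / n)) atTop (𝓝 0) := by
    simpa using (hces.const_mul c₁).add (hlog.const_mul c₂)
  refine squeeze_zero' (Eventually.of_forall fun n => by positivity) ?_ hlim
  filter_upwards [hcount] with n hn
  calc (pulls a i n : ℝ) / n ≤ (c₁ * ∑ t ∈ Finset.range n, selProb a y (batchStart a y t) i +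
        c₂ * Real.log (n + 1)) / n := div_le_div_of_nonneg_right hn (Nat.cast_nonneg n)
    _ = _ := by ring

lemma tendsto_pulls_ratio_zero
    (h0 : ∀ k, k ≠ b → Tendsto (fun n => (pulls a k n : ℝ) / n) atTop (𝓝 0)) (hib : i ≠ b) :
    Tendsto (fun n => (1 + (pulls a i n : ℝ)) / (1 + (pulls a b n : ℝ))) atTop (𝓝 0) := by
  have hinv : Tendsto (fun n : ℕ => 1 / (n : ℝ)) atTop (𝓝 0) :=
    tendsto_const_div_atTop_nhds_zero_nat 1
  have hnum := hinv.add (h0 i hib)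
  have hden : Tendsto (fun n : ℕ => 1 / (n : ℝ) +
      (1 - ∑ k ∈ Finset.univ.erase b, (pulls a k n : ℝ) / n)) atTop (𝓝 1) := by
    have h1 := tendsto_finsetSum (Finset.univ.erase b)
      fun k hk => h0 k (Finset.ne_of_mem_erase hk)
    have h2 := hinv.add (h1.const_sub 1)
    simpa using h2
  have h := hnum.div hden one_ne_zero
  rw [add_zero, zero_div] at h
  refine h.congr' ?_
  filter_upwards [eventually_gt_atTop 0] with n hn
  have hn' : (n : ℝ) ≠ 0 := Nat.cast_ne_zero.2 hn.ne'
  have hs := sum_pulls a n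
  rw [← Finset.add_sum_erase _ _ (Finset.mem_univ b)] at hs
  have hb : 1 / (n : ℝ) + (1 - ∑ k ∈ Finset.univ.erase b, (pulls a k n : ℝ) / n) =
      (1 + pulls a b n) / n := by
    rw [← Finset.sum_div]
    field_simp
    linarith
  have hb0 : (1 + (pulls a b n : ℝ)) ≠ 0 := by positivity
  simp only [Pi.div_apply]
  rw [hb]
  field_simp

end Path

/-! ### Logarithmic growth of pulls, regret and number of batches -/

lemma limsup_coe_le {u : ℕ → ℝ} {S : ℝ} (h : ∀ c > S, ∀ᶠ n in atTop, u n ≤ c) :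
    limsup (fun n => (u n : EReal)) atTop ≤ (S : EReal) := by
  refine le_of_forall_gt fun c hc => ?_
  obtain ⟨r, hr1, hr2⟩ := EReal.lt_iff_exists_real_btwn.1 hc
  refine lt_of_le_of_lt ?_ hr2
  refine limsup_le_of_le (h := ?_)
  exact (h r (EReal.coe_lt_coe_iff.1 hr1)).mono fun n hn => EReal.coe_le_coe_iff.2 hn

lemma tendsto_log_natCast_atTop : Tendsto (fun n : ℕ => Real.log n) atTop atTop :=
  Real.tendsto_log_atTop.comp tendsto_natCast_atTop_atTop

lemma log_natCast_add_one_le {n : ℕ} (hn : 2 ≤ n) : Real.log (n + 1) ≤ 2 * Real.log n := by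
  have hn' : (2 : ℝ) ≤ n := by exact_mod_cast hn
  have h : Real.log (n + 1) ≤ Real.log ((n : ℝ) ^ 2) :=
    Real.log_le_log (by positivity) (by nlinarith)
  rwa [Real.log_pow, Nat.cast_ofNat] at h

section Path

variable {I : ℕ} {a : ℕ → Fin I} {y : ℕ → Fin I → ℝ} {μ : Fin I → ℝ} {i b : Fin I}

/-- A suboptimal arm with gap `Δ` is pulled at most about `2 / Δ ^ 2 * log T` times. -/
lemma eventually_pulls_le_log (hI : 2 ≤ I) (hib : i ≠ b) {Δ : ℝ} (hΔ : 0 < Δ)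
    (hexp : ∀ κ, 0 < κ → κ < Δ ^ 2 / 2 →
      ∀ᶠ n in atTop, selProb a y n i ≤ Real.exp (-(κ * pulls a i n)))
    (hb : ∀ᶠ n in atTop, selProb a y n i ≤ selProb a y n b)
    (hwin : ∀ l : ℕ, ∀ᶠ n : ℕ in atTop, ∀ s ≤ n,
      (l : ℝ) * ∑ t ∈ Finset.Ico s n, (if a t = i then (1 : ℝ) else 0) ≤
        (Real.exp l - 1) * ∑ t ∈ Finset.Ico s n, selProb a y (batchStart a y t) i +
          3 * Real.log (n + 1)) {c : ℝ} (hc : 2 / Δ ^ 2 < c) :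
    ∀ᶠ T : ℕ in atTop, (pulls a i T : ℝ) ≤ c * Real.log T := by
  have hΔ2 : 0 < 2 / Δ ^ 2 := by positivity
  -- half of the room between `c` and `2 / Δ ^ 2` is spent on `κ`, the other half on `l`
  obtain ⟨g, hg⟩ : ∃ g, g = (c - 2 / Δ ^ 2) / 2 := ⟨_, rfl⟩
  have hg0 : 0 < g := by rw [hg]; linarith
  set κ := (2 / Δ ^ 2 + g)⁻¹ with hκ
  have hκ0 : 0 < κ := by positivity
  have hκlt : κ < Δ ^ 2 / 2 := by
    rw [hκ, ← inv_div 2 (Δ ^ 2)]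
    exact inv_strictAnti₀ hΔ2 (lt_add_of_pos_right _ hg0)
  obtain ⟨l, hl⟩ := exists_nat_gt (12 / g)
  have hl0 : (0 : ℝ) < l := (by positivity : 0 < 12 / g).trans hl
  have hl6 : 6 / (l : ℝ) ≤ g / 2 := by
    rw [div_lt_iff₀ hg0] at hl
    rw [div_le_div_iff₀ hl0 two_pos]
    linarith
  filter_upwards [eventually_exists_sum_selProb_le_two a y hI hib hκ0 (hexp κ hκ0 hκlt) hb,
    hwin l, eventually_ge_atTop 2,
    tendsto_log_natCast_atTop.eventually_ge_atTop (2 / g * ((Real.exp l - 1) * 2 / l))]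
    with T ⟨s, hsT, hs, hsum⟩ hw hT2 hTlog
  have hw' := hw s hsT
  have hN : (pulls a i T : ℝ) =
      pulls a i s + ∑ t ∈ Finset.Ico s T, (if a t = i then (1 : ℝ) else 0) := by
    rw [pulls_eq_sum, pulls_eq_sum, Finset.sum_range_add_sum_Ico _ hsT]
  have hlogT : 0 ≤ Real.log T := Real.log_natCast_nonneg T
  have he : 0 ≤ Real.exp l - 1 := by linarith [Real.one_le_exp hl0.le]
  have h1 : (l : ℝ) * ∑ t ∈ Finset.Ico s T, (if a t = i then (1 : ℝ) else 0) ≤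
      (Real.exp l - 1) * 2 + 3 * (2 * Real.log T) :=
    hw'.trans (add_le_add (mul_le_mul_of_nonneg_left hsum he)
      (mul_le_mul_of_nonneg_left (log_natCast_add_one_le hT2) (by norm_num)))
  have h2 : ∑ t ∈ Finset.Ico s T, (if a t = i then (1 : ℝ) else 0) ≤
      (Real.exp l - 1) * 2 / l + 6 / l * Real.log T := by
    rw [← mul_le_mul_iff_right₀ hl0]
    refine h1.trans (le_of_eq ?_)
    field_simp
    ring
  have h3 : (Real.exp l - 1) * 2 / l ≤ g / 2 * Real.log T := by
    have := mul_le_mul_of_nonneg_left hTlog (by positivity : 0 ≤ g / 2)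
    rwa [← mul_assoc, div_mul_div_cancel₀ two_ne_zero, div_self hg0.ne', one_mul] at this
  have h4 : 6 / l * Real.log T ≤ g / 2 * Real.log T := mul_le_mul_of_nonneg_right hl6 hlogT
  have h5 : Real.log T / κ = (2 / Δ ^ 2 + g) * Real.log T := by
    rw [hκ, div_inv_eq_mul, mul_comm]
  have h6 : c = 2 / Δ ^ 2 + 2 * g := by rw [hg]; ring
  rw [hN, h6]
  rw [h5] at hs
  linarith

/-- The realized regret decomposed over the suboptimal arms: gaps times numbers of pulls, and
centred rewards. -/
lemma regret_eq_sum (n : ℕ) : regret b a y n = ∑ i ∈ Finset.univ.erase b,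
    ((μ b - μ i) * pulls a i n +
      (∑ t ∈ Finset.range n, (if a t = i then 1 else 0) * (y t b - μ b) -
        ∑ t ∈ Finset.range n, (if a t = i then 1 else 0) * (y t i - μ i))) := by
  have h : ∀ t, y t b - y t (a t) =
      ∑ i ∈ Finset.univ.erase b, (if a t = i then 1 else 0) * (y t b - y t i) := fun t => by
    simp only [ite_mul, one_mul, zero_mul]
    rw [Finset.sum_ite_eq]
    split_ifs with h
    · rfl
    · have : a t = b := by simpa using h
      rw [this, sub_self]
  rw [regret, Finset.sum_congr rfl fun t _ => h t, Finset.sum_comm]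
  refine Finset.sum_congr rfl fun i _ => ?_
  rw [pulls_eq_sum, Finset.mul_sum, ← Finset.sum_sub_distrib, ← Finset.sum_add_distrib]
  refine Finset.sum_congr rfl fun t _ => ?_
  ring

/-- Bounds on the numbers of suboptimal pulls bound the realized regret, because the centred rewards
are negligible with respect to the numbers of pulls. -/
lemma limsup_regret_le (hμ : ∀ i, i ≠ b → μ i < μ b)
    (hN : ∀ i, i ≠ b → ∀ c > 2 / (μ b - μ i) ^ 2, ∀ᶠ T : ℕ in atTop,
      (pulls a i T : ℝ) ≤ c * Real.log T)
    (hrew : ∀ i k, Tendsto (fun n => (∑ t ∈ Finset.range n, (if a t = i then 1 else 0) *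
      (y t k - μ k)) / (1 + (pulls a i n : ℝ))) atTop (𝓝 0)) :
    limsup (fun T : ℕ => ((regret b a y T / Real.log T : ℝ) : EReal)) atTop ≤
      ((∑ i ∈ Finset.univ.erase b, 2 / (μ b - μ i) : ℝ) : EReal) := by
  refine limsup_coe_le fun c hc => ?_
  obtain ⟨δ, hδlt, hδ0⟩ : ∃ δ : ℝ, ∑ i ∈ Finset.univ.erase b,
      ((μ b - μ i + δ) * (2 / (μ b - μ i) ^ 2 + δ) + δ) < c ∧ 0 < δ := by
    have hcont : Continuous fun δ : ℝ => ∑ i ∈ Finset.univ.erase b,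
      ((μ b - μ i + δ) * (2 / (μ b - μ i) ^ 2 + δ) + δ) := by fun_prop
    have hlim := (hcont.tendsto 0).mono_left (nhdsWithin_le_nhds (s := Set.Ioi 0))
    have hval : ∑ i ∈ Finset.univ.erase b,
        ((μ b - μ i + 0) * (2 / (μ b - μ i) ^ 2 + 0) + 0) =
          ∑ i ∈ Finset.univ.erase b, 2 / (μ b - μ i) := by
      refine Finset.sum_congr rfl fun i hi => ?_
      have := (sub_pos.2 (hμ i (Finset.ne_of_mem_erase hi))).ne'
      field_simp
      ring
    rw [hval] at hlim
    exact ((hlim.eventually_lt_const hc).and self_mem_nhdsWithin).exists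
  have hN' : ∀ᶠ T : ℕ in atTop, ∀ i ∈ Finset.univ.erase b,
      (pulls a i T : ℝ) ≤ (2 / (μ b - μ i) ^ 2 + δ) * Real.log T :=
    (Finset.eventually_all _).2 fun i hi =>
      hN i (Finset.ne_of_mem_erase hi) _ (lt_add_of_pos_right _ hδ0)
  have hX : ∀ᶠ T : ℕ in atTop, ∀ i ∈ Finset.univ.erase b,
      ∑ t ∈ Finset.range T, (if a t = i then 1 else 0) * (y t b - μ b) -
        ∑ t ∈ Finset.range T, (if a t = i then 1 else 0) * (y t i - μ i) ≤
          δ * (1 + pulls a i T) :=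
    (Finset.eventually_all _).2 fun i _ => by
      have h := (hrew i b).sub (hrew i i)
      rw [sub_zero] at h
      filter_upwards [h.eventually_le_const hδ0] with T hT
      rwa [← sub_div, div_le_iff₀ (by positivity)] at hT
  filter_upwards [hN', hX, tendsto_log_natCast_atTop.eventually_ge_atTop 1] with T h1 h2 h3
  rw [div_le_iff₀ (zero_lt_one.trans_le h3), regret_eq_sum (μ := μ)]
  refine le_trans ?_ (mul_le_mul_of_nonneg_right hδlt.le (zero_le_one.trans h3))
  rw [Finset.sum_mul]
  refine Finset.sum_le_sum fun i hi => ?_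
  have hgap : 0 ≤ μ b - μ i + δ := by linarith [hμ i (Finset.ne_of_mem_erase hi)]
  have h4 := mul_le_mul_of_nonneg_left (h1 i hi) hgap
  have h5 := mul_le_mul_of_nonneg_left h3 hδ0.le
  linarith [h2 i hi]

/-- Each late batch adds almost one to the sum of the selection probabilities of the suboptimal arms,
which is asymptotic to the number of suboptimal pulls; so there are at most about as many batches as
suboptimal pulls. -/
lemma limsup_completedBatches_le (hI : 2 ≤ I)
    (hN : ∀ i, i ≠ b → ∀ c > 2 / (μ b - μ i) ^ 2, ∀ᶠ T : ℕ in atTop,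
      (pulls a i T : ℝ) ≤ c * Real.log T)
    (h0 : ∀ i, i ≠ b → Tendsto (fun n => selProb a y n i) atTop (𝓝 0))
    (hcount : Tendsto (fun n => ∑ t ∈ Finset.range n, ∑ i ∈ Finset.univ.erase b,
        selProb a y (batchStart a y t) i) atTop atTop →
      Tendsto (fun n => (∑ t ∈ Finset.range n, (∑ i ∈ Finset.univ.erase b,
        (if a t = i then (1 : ℝ) else 0) -
          ∑ i ∈ Finset.univ.erase b, selProb a y (batchStart a y t) i)) /
        (1 + ∑ t ∈ Finset.range n, ∑ i ∈ Finset.univ.erase b,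
          selProb a y (batchStart a y t) i)) atTop (𝓝 0)) :
    limsup (fun T : ℕ => (((completedBatches a y T : ℝ) / Real.log T : ℝ) : EReal)) atTop ≤
      ((∑ i ∈ Finset.univ.erase b, 2 / (μ b - μ i) ^ 2 : ℝ) : EReal) := by
  set Q : ℕ → ℝ := fun n => ∑ t ∈ Finset.range n, ∑ i ∈ Finset.univ.erase b,
    selProb a y (batchStart a y t) i with hQ
  have hQ0 : ∀ n, 0 ≤ Q n := fun n => Finset.sum_nonneg fun t _ =>
    Finset.sum_nonneg fun i _ => (selProb_pos a y _ i).le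
  have hQtop : Tendsto Q atTop atTop := by
    obtain ⟨C, hC⟩ := exists_completedBatches_le_sum_selProb a y hI b h0 one_half_pos
    have h1 : Tendsto (fun n => (1 - 1 / 2 : ℝ) * completedBatches a y n - C) atTop atTop :=
      tendsto_atTop_add_const_right _ (-C) ((tendsto_natCast_atTop_atTop.comp
        (tendsto_completedBatches a y hI)).const_mul_atTop (by norm_num))
    exact tendsto_atTop_mono (fun n => by linarith [hC n]) h1
  refine limsup_coe_le fun c hc => ?_
  obtain ⟨δ, hδlt, hδ0, hδ1⟩ : ∃ δ : ℝ, (∑ i ∈ Finset.univ.erase b,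
      (2 / (μ b - μ i) ^ 2 + δ) + δ) / (1 - δ) ^ 2 < c ∧ 0 < δ ∧ δ < 1 := by
    have hcont : ContinuousAt (fun δ : ℝ => (∑ i ∈ Finset.univ.erase b,
        (2 / (μ b - μ i) ^ 2 + δ) + δ) / (1 - δ) ^ 2) 0 :=
      ContinuousAt.div (by fun_prop) (by fun_prop) (by norm_num)
    have hlim := hcont.tendsto.mono_left (nhdsWithin_le_nhds (s := Set.Ioi 0))
    simp only [add_zero, sub_zero, one_pow, div_one] at hlim
    have hlt1 : ∀ᶠ δ : ℝ in 𝓝[>] 0, δ < 1 :=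
      nhdsWithin_le_nhds (eventually_lt_nhds zero_lt_one)
    obtain ⟨δ, h1, h3, h2⟩ :=
      ((hlim.eventually_lt_const hc).and (hlt1.and self_mem_nhdsWithin)).exists
    exact ⟨δ, h1, h2, h3⟩
  obtain ⟨C, hC⟩ := exists_completedBatches_le_sum_selProb a y hI b h0 hδ0
  have hN' : ∀ᶠ T : ℕ in atTop, ∀ i ∈ Finset.univ.erase b,
      (pulls a i T : ℝ) ≤ (2 / (μ b - μ i) ^ 2 + δ) * Real.log T :=
    (Finset.eventually_all _).2 fun i hi =>
      hN i (Finset.ne_of_mem_erase hi) _ (lt_add_of_pos_right _ hδ0)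
  filter_upwards [hN', (hcount hQtop).eventually_const_le (neg_lt_zero.2 hδ0),
    tendsto_log_natCast_atTop.eventually_ge_atTop 1,
    tendsto_log_natCast_atTop.eventually_ge_atTop (((1 - δ) * C + δ) / δ)] with T h1 h2 h3 h4
  have hlog0 : 0 < Real.log T := zero_lt_one.trans_le h3
  have hsumN : ∑ t ∈ Finset.range T, ∑ i ∈ Finset.univ.erase b, (if a t = i then (1 : ℝ) else 0) =
      ∑ i ∈ Finset.univ.erase b, (pulls a i T : ℝ) := by
    rw [Finset.sum_comm]
    exact Finset.sum_congr rfl fun i _ => (pulls_eq_sum a i T).symm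
  rw [Finset.sum_sub_distrib, hsumN, le_div_iff₀ (by linarith [hQ0 T])] at h2
  have h5 : ∑ i ∈ Finset.univ.erase b, (pulls a i T : ℝ) ≤
      (∑ i ∈ Finset.univ.erase b, (2 / (μ b - μ i) ^ 2 + δ)) * Real.log T := by
    rw [Finset.sum_mul]
    exact Finset.sum_le_sum h1
  have h6 : (1 - δ) * Q T ≤ ∑ i ∈ Finset.univ.erase b, (pulls a i T : ℝ) + δ := by
    change -δ * (1 + Q T) ≤ _ - Q T at h2
    linarith
  have h7 := mul_le_mul_of_nonneg_left (hC T) (sub_pos.2 hδ1).le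
  change _ ≤ (1 - δ) * (C + Q T) at h7
  have h8 : (1 - δ) * C + δ ≤ δ * Real.log T := by
    rw [div_le_iff₀ hδ0] at h4
    linarith
  have h9 : (1 - δ) ^ 2 * completedBatches a y T ≤
      (∑ i ∈ Finset.univ.erase b, (2 / (μ b - μ i) ^ 2 + δ) + δ) * Real.log T := by
    nlinarith
  have hsq : 0 < (1 - δ) ^ 2 := pow_pos (sub_pos.2 hδ1) 2
  refine le_trans ?_ hδlt.le
  rw [div_le_div_iff₀ hlog0 hsq]
  linarith

end Path

/-! ### The filtrations of the bandit, and the almost sure limit theorems along them -/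

section Bandit

variable {I : ℕ} {Ω : Type*} {Y θ : ℕ → Ω → Fin I → ℝ}
  {A : ℕ → Ω → Fin I}

lemma past_mono : Monotone (past Y θ A) := fun _ _ hst =>
  iSup_mono fun _ => iSup_mono' fun h => ⟨h.trans_le hst, le_rfl⟩

lemma le_past {s t : ℕ} (hst : s < t) :
    (MeasurableSpace.comap (Y s) inferInstance ⊔ MeasurableSpace.comap (θ s) inferInstance) ⊔
      MeasurableSpace.comap (A s) inferInstance ≤ past Y θ A t :=
  le_iSup₂_of_le s hst le_rfl

lemma measurable_action_indicator {m : MeasurableSpace Ω} {X : Ω → Fin I} (hX : Measurable[m] X)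
    (i : Fin I) : StronglyMeasurable[m] fun ω => if X ω = i then (1 : ℝ) else 0 :=
  (Measurable.ite (hX (measurableSet_singleton i)) measurable_const
    measurable_const).stronglyMeasurable

lemma measurable_action_past (t : ℕ) : Measurable[past Y θ A (t + 1)] (A t) :=
  (comap_measurable (A t)).mono (le_sup_right.trans (le_past t.lt_succ_self)) le_rfl

lemma measurable_reward_past (t : ℕ) : Measurable[past Y θ A (t + 1)] (Y t) :=
  (comap_measurable (Y t)).mono
    ((le_sup_left.trans le_sup_left).trans (le_past t.lt_succ_self)) le_rfl

lemma stronglyMeasurable_sum_indicator (J : Finset (Fin I)) (t : ℕ) :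
    StronglyMeasurable[past Y θ A (t + 1)]
      (fun ω => ∑ i ∈ J, (if A t ω = i then (1 : ℝ) else 0)) :=
  Finset.stronglyMeasurable_fun_sum _ fun i _ =>
    measurable_action_indicator (measurable_action_past t) i

variable [mΩ : MeasurableSpace Ω]

lemma past_le (hY : ∀ t, Measurable (Y t)) (hθ : ∀ t, Measurable (θ t))
    (hA : ∀ t, Measurable (A t)) (t : ℕ) : past Y θ A t ≤ mΩ :=
  iSup₂_le fun s _ => sup_le (sup_le (hY s).comap_le (hθ s).comap_le) (hA s).comap_le

/-- The filtration of everything that happened before a round. -/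
def pastFiltration (hY : ∀ t, Measurable (Y t)) (hθ : ∀ t, Measurable (θ t))
    (hA : ∀ t, Measurable (A t)) : Filtration ℕ mΩ where
  seq := past Y θ A
  mono' := past_mono
  le' := past_le hY hθ hA

/-- The filtration of everything that happened before a round, together with the samples and the
arm of that round, that is, of everything that precedes its rewards. -/
def actionFiltration (hY : ∀ t, Measurable (Y t)) (hθ : ∀ t, Measurable (θ t))
    (hA : ∀ t, Measurable (A t)) : Filtration ℕ mΩ where
  seq t := past Y θ A t ⊔ (MeasurableSpace.comap (θ t) inferInstance ⊔
    MeasurableSpace.comap (A t) inferInstance)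
  mono' := monotone_nat_of_le_succ fun t =>
    (sup_le (past_mono t.le_succ) ((sup_le (le_sup_of_le_left le_sup_right) le_sup_right).trans
      (le_past t.lt_succ_self))).trans le_sup_left
  le' t := sup_le (past_le hY hθ hA t) (sup_le (hθ t).comap_le (hA t).comap_le)

/-- Conditional probabilities have versions with values in the unit interval everywhere. -/
lemma exists_unitInterval_version {P : Measure Ω} (m : MeasurableSpace Ω) {D p : Ω → ℝ}
    (hDp : P[D | m] =ᵐ[P] p) (h0 : ∀ ω, 0 ≤ p ω) (h1 : ∀ᵐ ω ∂P, p ω ≤ 1) :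
    ∃ q : Ω → ℝ, StronglyMeasurable[m] q ∧ (∀ ω, 0 ≤ q ω) ∧ (∀ ω, q ω ≤ 1) ∧
      P[D | m] =ᵐ[P] q ∧ q =ᵐ[P] p := by
  have h : (fun ω => max 0 (min ((P[D | m]) ω) 1)) =ᵐ[P] p := by
    filter_upwards [hDp, h1] with ω hω h1ω
    rw [hω, min_eq_left h1ω, max_eq_right (h0 ω)]
  refine ⟨fun ω => max 0 (min ((P[D | m]) ω) 1), ?_, fun ω => le_max_left _ _,
    fun ω => max_le zero_le_one (min_le_right _ _), hDp.trans h.symm, h⟩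
  exact (measurable_const.max
    (stronglyMeasurable_condExp.measurable.min measurable_const)).stronglyMeasurable

variable {P : Measure Ω} [IsProbabilityMeasure P]

/-- Strong law of large numbers for the rewards that arm `k` produces in the rounds in which arm
`i` is played. -/
lemma ae_tendsto_sum_reward {μ : Fin I → ℝ} (hB : IsBandit P μ Y θ A)
    (hθ : ∀ t, Measurable (θ t)) (hA : ∀ t, Measurable (A t)) (i k : Fin I) :
    ∀ᵐ ω ∂P, Tendsto (pulls (fun t => A t ω) i) atTop atTop →
      Tendsto (fun n => (∑ t ∈ Finset.range n, (if A t ω = i then 1 else 0) * (Y t ω k - μ k)) /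
        (1 + (pulls (fun t => A t ω) i n : ℝ))) atTop (𝓝 0) := by
  set F := actionFiltration hB.measurable hθ hA with hF
  set u : ℕ → Ω → ℝ := fun t ω => if A t ω = i then 1 else 0 with hu
  have hAm : ∀ t, Measurable[F t] (A t) := fun t =>
    (comap_measurable (A t)).mono (le_sup_right.trans le_sup_right) le_rfl
  have hum : ∀ t, StronglyMeasurable[F t] (u t) := fun t => measurable_action_indicator (hAm t) i
  have hu0 : ∀ t ω, 0 ≤ u t ω := fun t ω => by simp only [hu]; split_ifs <;> norm_num
  have hu1 : ∀ t ω, u t ω ≤ 1 := fun t ω => by simp only [hu]; split_ifs <;> norm_num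
  have hub : ∀ t ω, ‖u t ω‖ ≤ 1 := fun t ω => by
    rw [Real.norm_of_nonneg (hu0 t ω)]; exact hu1 t ω
  have hXm : ∀ t, StronglyMeasurable[MeasurableSpace.comap (Y t) inferInstance]
      (fun ω => Y t ω k - μ k) := fun t =>
    (((measurable_pi_apply k).comp (comap_measurable (Y t))).sub_const (μ k)).stronglyMeasurable
  have hXF : ∀ t, MeasurableSpace.comap (Y t) inferInstance ≤ F (t + 1) := fun t =>
    ((measurable_reward_past t).comap_le).trans le_sup_left
  have hXL : ∀ t, MemLp (fun ω => Y t ω k - μ k) 2 P := fun t =>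
    ((hB.identDistrib t k).memLp_iff.2 (hB.memLp k)).sub (memLp_const (μ k))
  have hXmean : ∀ t, ∫ ω, (Y t ω k - μ k) ∂P = 0 := fun t => by
    rw [integral_sub (((hB.identDistrib t k).memLp_iff.2 (hB.memLp k)).integrable one_le_two)
      (integrable_const _), (hB.identDistrib t k).integral_eq, hB.mean k]
    simp
  have hXvar : ∀ t, ∫ ω, (Y t ω k - μ k) ^ 2 ∂P = ∫ ω, (Y 0 ω k - μ k) ^ 2 ∂P := fun t =>
    ((hB.identDistrib t k).comp (u := fun x => (x - μ k) ^ 2) (by fun_prop)).integral_eq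
  have h := ae_tendsto_sum_div (P := P) F (ξ := fun t ω => u t ω * (Y t ω k - μ k)) (u := u)
    (σ := ∫ ω, (Y 0 ω k - μ k) ^ 2 ∂P)
    (fun t => ((hum t).mono (F.mono t.le_succ)).mul ((hXm t).mono (hXF t)))
    (fun t => (hXL t).mono (((hum t).mono (F.le t)).aestronglyMeasurable.mul (hXL t).1)
      (Eventually.of_forall fun ω => by
        rw [norm_mul]; exact mul_le_of_le_one_left (norm_nonneg _) (hub t ω)))
    (fun t => by
      have h1 := condExp_stronglyMeasurable_mul_of_bound (F.le t) (hum t)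
        ((hXL t).integrable one_le_two) 1 (Eventually.of_forall (hub t))
      have h2 := condExp_indep_eq (hB.measurable t).comap_le (F.le t) (hXm t) (hB.indep t)
      filter_upwards [h1, h2] with ω h1 h2
      change (P[u t * (fun ω => Y t ω k - μ k) | F t]) ω = 0
      rw [h1, Pi.mul_apply, h2, hXmean t, mul_zero])
    hum hu0 hu1
    (fun t => by
      have hsqm := (hXm t).pow 2
      have h1 := condExp_stronglyMeasurable_mul_of_bound (F.le t) (hum t)
        (hXL t).integrable_sq 1 (Eventually.of_forall (hub t))
      have h2 := condExp_indep_eq (hB.measurable t).comap_le (F.le t) hsqm (hB.indep t)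
      have heq : (fun ω => (u t ω * (Y t ω k - μ k)) ^ 2) =
          u t * fun ω => (Y t ω k - μ k) ^ 2 := by
        funext ω
        simp only [hu, Pi.mul_apply]
        split_ifs <;> ring
      rw [heq]
      filter_upwards [h1, h2] with ω h1 h2
      rw [h1, Pi.mul_apply]
      refine le_of_eq ?_
      rw [← hXvar t, mul_comm]
      exact congrArg (· * u t ω) h2)
    (integral_nonneg fun ω => sq_nonneg _)
  filter_upwards [h] with ω hω hN
  have hsum : ∀ n, ∑ t ∈ Finset.range n, u t ω = pulls (fun t => A t ω) i n := fun n =>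
    (pulls_eq_sum (fun t => A t ω) i n).symm
  simp_rw [hsum] at hω
  exact hω (tendsto_natCast_atTop_atTop.comp hN)

/-- Given the past of a round, arm `i` is played with its selection probability at the start of the
current batch. -/
lemma condExp_action (hTS : IsThompsonSamplingIPASE P Y θ A)
    (i : Fin I) (t : ℕ) :
    P[fun ω => if A t ω = i then (1 : ℝ) else 0 | past Y θ A t] =ᵐ[P] fun ω =>
      selProb (fun s => A s ω) (fun s => Y s ω)
        (batchStart (fun s => A s ω) (fun s => Y s ω) t) i := by
  -- the event is sandwiched between strict and non-strict maximality of the sample of arm `i`,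
  -- which have the same posterior probability
  set S : Set (Fin I → ℝ) := {x | ∀ k, x k ≤ x i} with hS
  set S' : Set (Fin I → ℝ) := {x | ∀ k, k ≠ i → x k < x i} with hS'
  have hSm : MeasurableSet S := by
    simp only [hS, Set.ofPred_forall]
    exact MeasurableSet.iInter fun k =>
      measurableSet_le (measurable_pi_apply k) (measurable_pi_apply i)
  have hSm' : MeasurableSet S' := by
    simp only [hS', Set.ofPred_forall]
    exact MeasurableSet.iInter fun k => MeasurableSet.iInter fun _ =>
      measurableSet_lt (measurable_pi_apply k) (measurable_pi_apply i)
  have hind : ∀ R : Set (Fin I → ℝ), MeasurableSet R →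
      Integrable ((θ t ⁻¹' R).indicator fun _ => (1 : ℝ)) P := fun R hR =>
    (integrable_const 1).indicator (hTS.measurable_sample t hR)
  have hDi : Integrable (fun ω => if A t ω = i then (1 : ℝ) else 0) P :=
    Integrable.of_bound (C := 1)
      (measurable_action_indicator (hTS.measurable_action t) i).aestronglyMeasurable
      (Eventually.of_forall fun ω => by split_ifs <;> simp)
  have hup : (fun ω => if A t ω = i then (1 : ℝ) else 0) ≤ᵐ[P]
      (θ t ⁻¹' S).indicator fun _ => (1 : ℝ) := by
    filter_upwards [hTS.action_argmax t] with ω hω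
    split_ifs with h
    · rw [h] at hω
      rw [Set.indicator_of_mem (show ω ∈ θ t ⁻¹' S from hω)]
    · exact Set.indicator_nonneg (fun _ _ => zero_le_one) ω
  have hlow : (θ t ⁻¹' S').indicator (fun _ => (1 : ℝ)) ≤ᵐ[P]
      fun ω => if A t ω = i then (1 : ℝ) else 0 := by
    filter_upwards [hTS.action_argmax t] with ω hω
    by_cases hmem : ω ∈ θ t ⁻¹' S'
    · have : A t ω = i := by
        by_contra hne
        exact absurd (hω i) (not_le.2 (hmem (A t ω) hne))
      rw [Set.indicator_of_mem hmem, if_pos this]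
    · rw [Set.indicator_of_notMem hmem]
      split_ifs <;> norm_num
  filter_upwards [condExp_mono (m := past Y θ A t) hDi (hind S hSm) hup,
    condExp_mono (m := past Y θ A t) (hind S' hSm') hDi hlow, hTS.sample_law t S hSm,
    hTS.sample_law t S' hSm'] with ω h1 h2 h3 h4
  rw [h3] at h1
  rw [h4] at h2
  refine le_antisymm h1 ?_
  rw [selProb, posterior, pi_gaussianReal_argmax_eq_strict _ (postVar_ne_zero _ _)]
  exact h2

end Bandit

section Counts

variable {I : ℕ} {Ω : Type*} [mΩ : MeasurableSpace Ω] {P : Measure Ω} [IsProbabilityMeasure P]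
  {Y θ : ℕ → Ω → Fin I → ℝ} {A : ℕ → Ω → Fin I}

/-- The sum of the selection probabilities of the arms in `J`, given the feedback that is available
in round `t`. -/
noncomputable def selProbOf (Y : ℕ → Ω → Fin I → ℝ) (A : ℕ → Ω → Fin I) (J : Finset (Fin I))
    (t : ℕ) (ω : Ω) : ℝ :=
  ∑ i ∈ J, selProb (fun s => A s ω) (fun s => Y s ω)
    (batchStart (fun s => A s ω) (fun s => Y s ω) t) i

lemma sum_indicator_eq_zero_or_one (J : Finset (Fin I)) (k : Fin I) :
    ∑ i ∈ J, (if k = i then (1 : ℝ) else 0) = 0 ∨ ∑ i ∈ J, (if k = i then (1 : ℝ) else 0) = 1 := by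
  rw [Finset.sum_ite_eq]
  split_ifs <;> simp

/-- The summed selection probabilities of a set of arms are versions of the conditional probabilities
that an arm of this set is played. The version `q` is measurable with respect to the past by
construction, so that measurability of the selection probabilities themselves is not needed. -/
lemma exists_compensator (hTS : IsThompsonSamplingIPASE P Y θ A) (J : Finset (Fin I)) :
    ∃ q : ℕ → Ω → ℝ, (∀ t, StronglyMeasurable[past Y θ A t] (q t)) ∧ (∀ t ω, 0 ≤ q t ω) ∧
      (∀ t ω, q t ω ≤ 1) ∧
      (∀ t, P[fun ω => ∑ i ∈ J, (if A t ω = i then (1 : ℝ) else 0) | past Y θ A t] =ᵐ[P] q t) ∧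
      ∀ᵐ ω ∂P, ∀ t, q t ω = selProbOf Y A J t ω := by
  have hDi : ∀ (t : ℕ) (i : Fin I), Integrable (fun ω => if A t ω = i then (1 : ℝ) else 0) P :=
    fun t i => Integrable.of_bound (C := 1)
      (measurable_action_indicator (hTS.measurable_action t) i).aestronglyMeasurable
      (Eventually.of_forall fun ω => by split_ifs <;> simp)
  have hcond : ∀ t, P[fun ω => ∑ i ∈ J, (if A t ω = i then (1 : ℝ) else 0) | past Y θ A t] =ᵐ[P]
      selProbOf Y A J t := fun t => by
    have h1 := condExp_finsetSum (s := J) (μ := P)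
      (f := fun i ω => if A t ω = i then (1 : ℝ) else 0) (fun i _ => hDi t i) (past Y θ A t)
    have h2 : (∑ i ∈ J, fun ω => if A t ω = i then (1 : ℝ) else 0) =
        fun ω => ∑ i ∈ J, (if A t ω = i then (1 : ℝ) else 0) := by
      funext ω; simp only [Finset.sum_apply]
    rw [h2] at h1
    have h3 : ∀ᵐ ω ∂P, ∀ i, (P[fun ω => if A t ω = i then (1 : ℝ) else 0 | past Y θ A t]) ω =
        selProb (fun s => A s ω) (fun s => Y s ω)
          (batchStart (fun s => A s ω) (fun s => Y s ω) t) i :=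
      ae_all_iff.2 fun i => condExp_action hTS i t
    filter_upwards [h1, h3] with ω h1 h3
    rw [h1, Finset.sum_apply, selProbOf]
    exact Finset.sum_congr rfl fun i _ => h3 i
  have hle : ∀ t, ∀ᵐ ω ∂P, selProbOf Y A J t ω ≤ 1 := fun t => by
    have h1 : P[fun ω => ∑ i ∈ J, (if A t ω = i then (1 : ℝ) else 0) | past Y θ A t] ≤ᵐ[P]
        P[fun _ => (1 : ℝ) | past Y θ A t] :=
      condExp_mono (integrable_finsetSum _ fun i _ => hDi t i) (integrable_const 1)
        (Eventually.of_forall fun ω => by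
          rcases sum_indicator_eq_zero_or_one J (A t ω) with h | h
          · exact h.trans_le zero_le_one
          · exact h.le)
    by_cases hm : past Y θ A t ≤ mΩ
    · rw [condExp_const hm] at h1
      filter_upwards [h1, hcond t] with ω h1 h2
      rwa [← h2]
    · filter_upwards [hcond t] with ω h2
      rw [← h2, condExp_of_not_le hm]
      exact zero_le_one
  choose q hq1 hq2 hq3 hq4 hq5 using fun t => exists_unitInterval_version (past Y θ A t) (hcond t)
    (fun ω => Finset.sum_nonneg fun i _ => (selProb_pos _ _ _ i).le) (hle t)
  exact ⟨q, hq1, hq2, hq3, hq4, ae_all_iff.2 hq5⟩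

lemma ae_tendsto_action_count (hY : ∀ t, Measurable (Y t))
    (hTS : IsThompsonSamplingIPASE P Y θ A) (J : Finset (Fin I)) :
    ∀ᵐ ω ∂P, Tendsto (fun n => ∑ t ∈ Finset.range n, selProbOf Y A J t ω) atTop atTop →
      Tendsto (fun n => (∑ t ∈ Finset.range n,
        (∑ i ∈ J, (if A t ω = i then (1 : ℝ) else 0) - selProbOf Y A J t ω)) /
        (1 + ∑ t ∈ Finset.range n, selProbOf Y A J t ω)) atTop (𝓝 0) := by
  obtain ⟨q, hqm, hq0, hq1, hDq, hq⟩ := exists_compensator hTS J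
  have h := ae_tendsto_count_sub_div (P := P)
    (pastFiltration hY hTS.measurable_sample hTS.measurable_action)
    (D := fun t ω => ∑ i ∈ J, (if A t ω = i then (1 : ℝ) else 0)) (q := q)
    (stronglyMeasurable_sum_indicator J)
    (fun t ω => sum_indicator_eq_zero_or_one J (A t ω)) hqm hq0 hq1 hDq
  filter_upwards [h, hq] with ω h hq
  simp_rw [hq] at h
  exact h

lemma ae_eventually_action_count_le (hY : ∀ t, Measurable (Y t))
    (hTS : IsThompsonSamplingIPASE P Y θ A) (J : Finset (Fin I)) (l : ℕ) :
    ∀ᵐ ω ∂P, ∀ᶠ n : ℕ in atTop, ∀ s ≤ n,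
      (l : ℝ) * ∑ t ∈ Finset.Ico s n, ∑ i ∈ J, (if A t ω = i then (1 : ℝ) else 0) ≤
        (Real.exp l - 1) * ∑ t ∈ Finset.Ico s n, selProbOf Y A J t ω + 3 * Real.log (n + 1) := by
  obtain ⟨q, hqm, hq0, hq1, hDq, hq⟩ := exists_compensator hTS J
  have h := ae_eventually_count_le (P := P)
    (pastFiltration hY hTS.measurable_sample hTS.measurable_action)
    (D := fun t ω => ∑ i ∈ J, (if A t ω = i then (1 : ℝ) else 0)) (q := q)
    (stronglyMeasurable_sum_indicator J)
    (fun t ω => sum_indicator_eq_zero_or_one J (A t ω)) hqm hq0 hDq (Nat.cast_nonneg l)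
  filter_upwards [h, hq] with ω h hq
  simp_rw [hq] at h
  exact h

end Counts

/-! ### The almost sure bounds -/

section Path

variable {I : ℕ} {a : ℕ → Fin I} {y : ℕ → Fin I → ℝ} {μ : Fin I → ℝ} {b : Fin I}

lemma tendsto_pulls_of_count {i : Fin I}
    (h : Tendsto (fun n => (∑ t ∈ Finset.range n, ((if a t = i then (1 : ℝ) else 0) -
        selProb a y (batchStart a y t) i)) /
      (1 + ∑ t ∈ Finset.range n, selProb a y (batchStart a y t) i)) atTop (𝓝 0))
    (hQ : Tendsto (fun n => ∑ t ∈ Finset.range n, selProb a y (batchStart a y t) i)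
      atTop atTop) : Tendsto (pulls a i) atTop atTop := by
  refine tendsto_natCast_atTop_iff (R := ℝ).1 ?_
  have hlin := tendsto_atTop_add_const_right _ (-1 / 2 : ℝ)
    (hQ.const_mul_atTop (one_half_pos (α := ℝ)))
  refine tendsto_atTop_mono' _ ?_ hlin
  filter_upwards [h.eventually_const_le (show (-1 / 2 : ℝ) < 0 by norm_num),
    hQ.eventually_ge_atTop 0] with n hn hn0
  rw [Finset.sum_sub_distrib, ← pulls_eq_sum, le_div_iff₀ (by linarith)] at hn
  linarith

/-- The two bounds for a trajectory along which the laws of large numbers for rewards and counts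
hold, as does the logarithmic bound on the counts of a window. -/
lemma limsup_le_of_trajectory (hI : 2 ≤ I) (hμ : ∀ i, i ≠ b → μ i < μ b)
    (hrew : ∀ i k, Tendsto (pulls a i) atTop atTop →
      Tendsto (fun n => (∑ t ∈ Finset.range n, (if a t = i then 1 else 0) * (y t k - μ k)) /
        (1 + (pulls a i n : ℝ))) atTop (𝓝 0))
    (hcount : ∀ J : Finset (Fin I),
      Tendsto (fun n => ∑ t ∈ Finset.range n, ∑ i ∈ J, selProb a y (batchStart a y t) i)
        atTop atTop →
      Tendsto (fun n => (∑ t ∈ Finset.range n, (∑ i ∈ J, (if a t = i then (1 : ℝ) else 0) -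
          ∑ i ∈ J, selProb a y (batchStart a y t) i)) /
        (1 + ∑ t ∈ Finset.range n, ∑ i ∈ J, selProb a y (batchStart a y t) i)) atTop (𝓝 0))
    (hwin : ∀ (i : Fin I) (l : ℕ), ∀ᶠ n : ℕ in atTop, ∀ s ≤ n,
      (l : ℝ) * ∑ t ∈ Finset.Ico s n, (if a t = i then (1 : ℝ) else 0) ≤
        (Real.exp l - 1) * ∑ t ∈ Finset.Ico s n, selProb a y (batchStart a y t) i +
          3 * Real.log (n + 1)) :
    limsup (fun T : ℕ => ((regret b a y T / Real.log T : ℝ) : EReal)) atTop ≤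
        ((∑ i ∈ Finset.univ.erase b, 2 / (μ b - μ i) : ℝ) : EReal) ∧
      limsup (fun T : ℕ => (((completedBatches a y T : ℝ) / Real.log T : ℝ) : EReal)) atTop ≤
        ((∑ i ∈ Finset.univ.erase b, 2 / (μ b - μ i) ^ 2 : ℝ) : EReal) := by
  have hpull : ∀ i, Tendsto (pulls a i) atTop atTop :=
    tendsto_pulls a y hI (μ := μ) (fun i hi => tendsto_postMean a y hi (hrew i i hi))
      fun i hQ => by
        have h := hcount {i}
        simp only [Finset.sum_singleton] at h
        exact tendsto_pulls_of_count (h hQ) hQ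
  have hmean : ∀ i, Tendsto (fun n => postMean a y n i) atTop (𝓝 (μ i)) := fun i =>
    tendsto_postMean a y (hpull i) (hrew i i (hpull i))
  have hsel : ∀ i, i ≠ b → Tendsto (fun n => selProb a y n i) atTop (𝓝 0) := fun i hib =>
    tendsto_selProb_zero hib (hμ i hib) (hpull i) (hpull b) (hmean i) (hmean b)
  have hfrac : ∀ i, i ≠ b → Tendsto (fun n => (pulls a i n : ℝ) / n) atTop (𝓝 0) := fun i hib =>
    tendsto_pulls_div_zero hI (hsel i hib) (c₁ := Real.exp 1 - 1) (c₂ := 3) <| by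
      filter_upwards [hwin i 1] with n hn
      have h := hn 0 (Nat.zero_le n)
      rwa [← Finset.range_eq_Ico, ← pulls_eq_sum, Nat.cast_one, one_mul] at h
  have hbest : ∀ i, i ≠ b → ∀ᶠ n in atTop, selProb a y n i ≤ selProb a y n b := fun i hib => by
    have hsum := tendsto_finsetSum (Finset.univ.erase b)
      fun j hj => hsel j (Finset.ne_of_mem_erase hj)
    simp only [Finset.sum_const_zero] at hsum
    filter_upwards [(hsel i hib).eventually_le_const one_half_pos,
      hsum.eventually_le_const one_half_pos] with n h1 h2
    have h3 := one_le_sum_selProb a y hI n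
    rw [← Finset.add_sum_erase _ _ (Finset.mem_univ b)] at h3
    linarith
  have hN : ∀ i, i ≠ b → ∀ c > 2 / (μ b - μ i) ^ 2, ∀ᶠ T : ℕ in atTop,
      (pulls a i T : ℝ) ≤ c * Real.log T := fun i hib c hc =>
    eventually_pulls_le_log hI hib (sub_pos.2 (hμ i hib))
      (fun κ hκ0 hκ => eventually_selProb_le_exp hib (hμ i hib) (hmean i) (hmean b)
        (tendsto_pulls_ratio_zero hfrac hib) hκ0.le hκ) (hbest i hib) (hwin i) hc
  exact ⟨limsup_regret_le hμ hN fun i k => hrew i k (hpull i),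
    limsup_completedBatches_le hI hN hsel (hcount _)⟩

end Path

end BatchedBandit

theorem theorem2 {Ω : Type*} [MeasurableSpace Ω] (P : Measure Ω) [IsProbabilityMeasure P]
    (I : ℕ) (hI : 2 ≤ I) (μ : Fin I → ℝ) (best : Fin I) (hbest : ∀ i, i ≠ best → μ i < μ best)
    (Y θ : ℕ → Ω → Fin I → ℝ) (A : ℕ → Ω → Fin I)
    (hY : BatchedBandit.IsBandit P μ Y θ A)
    (hTS : BatchedBandit.IsThompsonSamplingIPASE P Y θ A) :
    (∀ᵐ ω ∂P,
      limsup (fun T : ℕ =>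
        ((BatchedBandit.regret best (fun t => A t ω) (fun t => Y t ω) T / Real.log T : ℝ) : EReal))
        atTop
      ≤ ((∑ i ∈ Finset.univ.erase best, 2 / (μ best - μ i) : ℝ) : EReal)) ∧
    (∀ᵐ ω ∂P,
      limsup (fun T : ℕ =>
        (((BatchedBandit.completedBatches (fun t => A t ω) (fun t => Y t ω) T : ℝ) / Real.log T : ℝ)
          : EReal)) atTop
      ≤ ((∑ i ∈ Finset.univ.erase best, 2 / (μ best - μ i) ^ 2 : ℝ) : EReal)) := by
  rw [← eventually_and]
  have hrew := ae_all_iff.2 fun i => ae_all_iff.2 fun k =>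
    BatchedBandit.ae_tendsto_sum_reward hY hTS.measurable_sample hTS.measurable_action i k
  have hcount := ae_all_iff.2 fun J =>
    BatchedBandit.ae_tendsto_action_count hY.measurable hTS J
  have hwin := ae_all_iff.2 fun i : Fin I => ae_all_iff.2 fun l =>
    BatchedBandit.ae_eventually_action_count_le hY.measurable hTS {i} l
  filter_upwards [hrew, hcount, hwin] with ω hrew hcount hwin
  simp only [BatchedBandit.selProbOf, Finset.sum_singleton] at hcount hwin
  exact BatchedBandit.limsup_le_of_trajectory hI hbest hrew hcount hwin
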